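/- Let $\mathfrak X$ be a countably infinite alphabet, $\mathfrak X^*$ the free monoid of words over $\mathfrak X$, and let $x$, $y_i,z_i,t_i$ $(i\ge 1)$ be distinct letters of $\mathfrak X$. A letter is simple [multiple] in a word $\mathbf w$ if it occurs in $\mathbf w$ exactly once [at least twice]; the blocks of $\mathbf w$ are the maximal factors of $\mathbf w$ containing no letter that is simple in $\mathbf w$. Define relations on $\mathfrak X^*$: $\mathbf u\mathrel{\gamma}\mathbf v$ iff $\mathbf u$ and $\mathbf v$ have the same simple letters and $\mathbf u$ is obtained from $\mathbf v$ by changing the individual (positive) exponents of letters; $\mathbf u\mathrel{\beta}\mathbf v$ iff $\mathbf u\mathrel{\gamma}\mathbf v$ and, for each multiple letter, its first two occurrences lie in the same block of $\mathbf u$ if and only if they lie in the same block of $\mathbf v$. The relation $\beta$ is a congruence on $\mathfrak X^*$; write $[\mathbf w]^\beta$ for the $\beta$-class of $\mathbf w$. For a $\beta$-class $\mathtt u$, let $M_\beta(\mathtt u)$ be the Rees quotient of $\mathfrak X^*/\beta$ over the ideal of all $\beta$-classes $\mathtt v$ that are not factors of $\mathtt u$ (that is, $\mathtt u\neq\mathtt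 p\mathtt v\mathtt s$ for all $\mathtt p,\mathtt s\in\mathfrak X^*/\beta$), and let $\mathbf M_\beta(\mathtt u)$ be the variety of monoids generated by $M_\beta(\mathtt u)$. For $k\ge 1$ and a permutation $\pi$ of $\{1,\dots,k\}$ (with $i\pi$ the image of $i$) put $$\mathbf a_{0,k}[\pi]:=x\Bigl(\prod_{i=1}^{k-1}z_{i\pi}y_i^2\Bigr)z_{k\pi}\,x\Bigl(\prod_{i=1}^{k}t_iz_i\Bigr).$$ **Proposition.** For every $k\ge 2$ and every $\pi\in S_k$, the lattice of all subvarieties of $\mathbf M_\beta\bigl([\mathbf a_{0,k}[\pi]]^\beta\bigr)$ is not distributive. -/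

import Mathlib

universe u v

/-! ### Words -/

/-- The countably infinite alphabet: the letter `x` and the letters `y_i`, `z_i`, `t_i`. -/
inductive Letter : Type
  | x : Letter
  | y : ℕ → Letter
  | z : ℕ → Letter
  | t : ℕ → Letter
  deriving DecidableEq

instance Letter.instInfinite : Infinite Letter :=
  Infinite.of_injective Letter.y (fun _ _ h => by injection h)

instance Letter.instCountable : Countable Letter := by
  let f : Letter → ℕ × ℕ := fun l =>
    match l with
    | .x => (0, 0)
    | .y i => (1, i)
    | .z i => (2, i)
    | .t i => (3, i)
  have hf : Function.Injective f := by
    intro a b h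
    cases a <;> cases b <;> simp_all [f]
  exact hf.countable

/-- The free monoid over the alphabet. -/
abbrev Word : Type := FreeMonoid Letter

namespace Word

/-- The letter `a` is simple in `w`: it occurs exactly once. -/
def IsSimple (a : Letter) (w : Word) : Prop := w.toList.count a = 1

/-- The letter `a` is multiple in `w`: it occurs at least twice. -/
def IsMultiple (a : Letter) (w : Word) : Prop := 2 ≤ w.toList.count a

/-- The sequence of bases of the islands of `w`: every maximal power `a ^ e` of a letter (`1 ≤ e`)
is replaced by `a`. Two words have the same skeleton iff one is obtained from the other by changing
the (positive) individual exponents of letters. -/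
def skeleton (w : Word) : List Letter := w.toList.destutter (· ≠ ·)

/-- The first two occurrences of `a` exist and lie in the same block of `w`. The blocks of `w` are
the maximal factors of `w` that contain no letter that is simple in `w`, so this says
that `w = p a q a r` with these two occurrences of `a` the first ones, where no letter of `q` is
simple in `w`. -/
def FirstTwoInSameBlock (a : Letter) (w : Word) : Prop :=
  ∃ p q r : List Letter, w.toList = p ++ a :: (q ++ a :: r) ∧ a ∉ p ∧ a ∉ q ∧
    ∀ b ∈ q, ¬ IsSimple b w

/-- The relation `γ`. -/
def GammaRel (w₁ w₂ : Word) : Prop :=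
  (∀ a, IsSimple a w₁ ↔ IsSimple a w₂) ∧ skeleton w₁ = skeleton w₂

/-- The relation `β`. -/
def BetaRel (w₁ w₂ : Word) : Prop :=
  GammaRel w₁ w₂ ∧
    ∀ a, IsMultiple a w₁ → (FirstTwoInSameBlock a w₁ ↔ FirstTwoInSameBlock a w₂)

end Word

namespace Word

/-! ### `β` is a congruence -/

theorem destutter'_aux (l m : List Letter) (a c : Letter) :
    (a :: l ++ m).destutter' (· ≠ ·) c = (l.destutter' (· ≠ ·) a ++ m).destutter' (· ≠ ·) c := by
  induction l generalizing a c with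
  | nil => rfl
  | cons b l ih =>
    by_cases hab : a = b
    · subst hab
      rw [List.destutter'_cons_neg (a := a) (b := a) l (by simp), ← ih]
      by_cases hca : c = a
      · subst hca; simp
      · simp [hca]
    · rw [List.destutter'_cons_pos (b := a) l hab]
      have h1 := ih b a
      have h2 := ih b c
      simp only [List.cons_append] at h1 h2 ⊢
      by_cases hca : c = a
      · subst hca
        rw [List.destutter'_cons_neg (a := c) _ (by simp), h2,
          List.destutter'_cons_neg (a := c) _ (by simp)]
      · rw [List.destutter'_cons_pos (a := a) _ hca, List.destutter'_cons_pos (a := a) _ hca, h1]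

theorem destutter'_destutter (l : List Letter) (c : Letter) :
    l.destutter' (· ≠ ·) c = (l.destutter (· ≠ ·)).destutter' (· ≠ ·) c := by
  cases l with
  | nil => rfl
  | cons a l =>
    have := destutter'_aux l [] a c
    rwa [List.append_nil, List.append_nil] at this

theorem destutter'_append (l m : List Letter) (c : Letter) :
    (l ++ m).destutter' (· ≠ ·) c
      = (l.destutter (· ≠ ·) ++ m.destutter (· ≠ ·)).destutter' (· ≠ ·) c := by
  induction l generalizing c with
  | nil => simpa using destutter'_destutter m c
  | cons a l ih =>
    rw [List.destutter_cons', ← destutter'_aux]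
    simp only [List.cons_append]
    have key : ∀ d, (l ++ m).destutter' (· ≠ ·) d =
        (l ++ m.destutter (· ≠ ·)).destutter' (· ≠ ·) d := by
      intro d
      rw [ih d]
      cases l with
      | nil => simp
      | cons b l => rw [List.destutter_cons', ← destutter'_aux]
    by_cases hca : c = a
    · subst hca
      rw [List.destutter'_cons_neg _ (by simp), List.destutter'_cons_neg _ (by simp), key]
    · rw [List.destutter'_cons_pos _ hca, List.destutter'_cons_pos _ hca, key]

theorem destutter_append_congr {l l' m m' : List Letter}
    (h : l.destutter (· ≠ ·) = l'.destutter (· ≠ ·))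
    (h' : m.destutter (· ≠ ·) = m'.destutter (· ≠ ·)) :
    (l ++ m).destutter (· ≠ ·) = (l' ++ m').destutter (· ≠ ·) := by
  cases l with
  | nil =>
    have : l' = [] := by
      rw [← List.destutter_eq_nil (R := (· ≠ ·)), ← h]; rfl
    subst this
    simpa using h'
  | cons a l =>
    cases l' with
    | nil => exact absurd h (by simp [List.destutter_cons', List.destutter'_ne_nil])
    | cons b l' =>
      have hab : a = b := by
        have h1 : ∀ (k : List Letter) (d : Letter), (k.destutter' (· ≠ ·) d).head? = some d := by
          intro k
          induction k with
          | nil => intro d; rfl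
          | cons e k ih =>
            intro d
            rw [List.destutter'_cons]
            split_ifs
            · rfl
            · exact ih d
        have := congrArg List.head? h
        simpa [List.destutter_cons', h1] using this
      subst hab
      have e1 : ∀ k : List Letter, (a :: k).destutter (· ≠ ·)
          = (a :: k).destutter' (· ≠ ·) a := by
        intro k
        rw [List.destutter_cons', List.destutter'_cons_neg _ (by simp)]
      rw [List.cons_append, List.cons_append, e1, e1, ← List.cons_append, ← List.cons_append,
        destutter'_append, destutter'_append (a :: l'), h, h']

theorem sublist_destutter'_aux (w l : List Letter) (c : Letter)
    (hl : (c :: l).IsChain (· ≠ ·)) (h : l.Sublist w) :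
    (c :: l).Sublist (w.destutter' (· ≠ ·) c) := by
  induction w generalizing c l with
  | nil =>
    have := List.sublist_nil.mp h
    subst this
    simp
  | cons b w ih =>
    by_cases hcb : c = b
    · subst hcb
      rw [List.destutter'_cons_neg _ (by simp)]
      refine ih l c hl ?_
      cases l with
      | nil => simp
      | cons d l =>
        have hcd : c ≠ d := by
          rw [List.isChain_cons_cons] at hl; exact hl.1
        rcases List.sublist_cons_iff.mp h with h | ⟨r, hr, -⟩
        · exact h
        · exact absurd (List.cons.inj hr).1.symm hcd
    · rw [List.destutter'_cons_pos _ hcb]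
      refine List.Sublist.cons_cons c ?_
      have hl' : l.IsChain (· ≠ ·) := by
        cases l with
        | nil => simp
        | cons d l => rw [List.isChain_cons_cons] at hl; exact hl.2
      cases l with
      | nil => simp
      | cons d l =>
        by_cases hdb : d = b
        · subst hdb
          exact ih l d hl' (List.cons_sublist_cons.mp h)
        · have h2 : (d :: l).Sublist w := by
            rcases List.sublist_cons_iff.mp h with h | ⟨r, hr, -⟩
            · exact h
            · exact absurd (List.cons.inj hr).1 hdb
          exact (List.sublist_cons_self b _).trans
            (ih (d :: l) b (List.isChain_cons_cons.mpr ⟨fun h => hdb h.symm, hl'⟩) h2)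

theorem sublist_destutter {w l : List Letter} (hl : l.IsChain (· ≠ ·)) (h : l.Sublist w) :
    l.Sublist (w.destutter (· ≠ ·)) := by
  cases w with
  | nil => simpa using h
  | cons b w =>
    rw [List.destutter_cons', show w.destutter' (· ≠ ·) b = (b :: w).destutter' (· ≠ ·) b by
      rw [List.destutter'_cons_neg _ (by simp)]]
    cases l with
    | nil => simp
    | cons d l =>
      by_cases hdb : d = b
      · subst hdb
        rw [List.destutter'_cons_neg _ (by simp)]
        exact sublist_destutter'_aux w l d hl (List.cons_sublist_cons.mp h)
      · exact (List.sublist_cons_self b _).trans (sublist_destutter'_aux (b :: w) (d :: l) b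
          (List.isChain_cons_cons.mpr ⟨fun h => hdb h.symm, hl⟩) h)

theorem GammaRel.symm {u v : Word} (h : GammaRel u v) : GammaRel v u :=
  ⟨fun a => (h.1 a).symm, h.2.symm⟩

theorem GammaRel.trans {u v w : Word} (h : GammaRel u v) (h' : GammaRel v w) : GammaRel u w :=
  ⟨fun a => (h.1 a).trans (h'.1 a), h.2.trans h'.2⟩

theorem GammaRel.sublist {u v : Word} (h : GammaRel u v) {l : List Letter}
    (hl : l.IsChain (· ≠ ·)) (hs : l.Sublist u.toList) : l.Sublist v.toList := by
  have h1 := sublist_destutter hl hs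
  have h2 : u.toList.destutter (· ≠ ·) = v.toList.destutter (· ≠ ·) := h.2
  rw [h2] at h1
  exact h1.trans (List.destutter_sublist _ _)

theorem GammaRel.mem_iff {u v : Word} (h : GammaRel u v) (a : Letter) :
    a ∈ u.toList ↔ a ∈ v.toList := by
  rw [← List.singleton_sublist, ← List.singleton_sublist]
  exact ⟨h.sublist (by simp), h.symm.sublist (by simp)⟩

theorem GammaRel.count_cases {u v : Word} (h : GammaRel u v) (a : Letter) :
    (u.toList.count a = 0 ∧ v.toList.count a = 0) ∨ (u.toList.count a = 1 ∧ v.toList.count a = 1) ∨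
      (2 ≤ u.toList.count a ∧ 2 ≤ v.toList.count a) := by
  have h1 : u.toList.count a = 1 ↔ v.toList.count a = 1 := h.1 a
  have h2 := h.mem_iff a
  rw [← List.count_pos_iff, ← List.count_pos_iff] at h2
  omega

theorem GammaRel.mul {u v u' v' : Word} (h : GammaRel u v) (h' : GammaRel u' v') :
    GammaRel (u * u') (v * v') := by
  constructor
  · intro a
    have h1 := h.count_cases a
    have h2 := h'.count_cases a
    simp only [IsSimple, FreeMonoid.toList_mul, List.count_append]
    omega
  · simp only [skeleton, FreeMonoid.toList_mul]
    exact destutter_append_congr h.2 h'.2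

theorem sublist_two {a b : Letter} {l m : List Letter} (h : [a, b].Sublist (l ++ m)) :
    [a, b].Sublist l ∨ (a ∈ l ∧ b ∈ m) ∨ [a, b].Sublist m := by
  obtain ⟨r, s, e, hr, hs⟩ := List.sublist_append_iff.mp h
  match r, e with
  | [], e => right; right; simpa [e] using hs
  | [_], e =>
    simp at e
    obtain ⟨rfl, rfl⟩ := e
    right; left; exact ⟨List.singleton_sublist.mp hr, List.singleton_sublist.mp hs⟩
  | _ :: _ :: _, e =>
    simp at e
    obtain ⟨rfl, rfl, rfl, rfl⟩ := e
    left; exact hr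

theorem sublist_three {a b c : Letter} {l m : List Letter} (h : [a, b, c].Sublist (l ++ m)) :
    [a, b, c].Sublist l ∨ ([a, b].Sublist l ∧ c ∈ m) ∨ (a ∈ l ∧ [b, c].Sublist m) ∨
      [a, b, c].Sublist m := by
  obtain ⟨r, s, e, hr, hs⟩ := List.sublist_append_iff.mp h
  match r, e with
  | [], e => right; right; right; simpa [e] using hs
  | [_], e =>
    simp at e
    obtain ⟨rfl, rfl⟩ := e
    right; right; left; exact ⟨List.singleton_sublist.mp hr, hs⟩
  | [_, _], e =>
    simp at e
    obtain ⟨rfl, rfl, rfl⟩ := e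
    right; left; exact ⟨hr, List.singleton_sublist.mp hs⟩
  | _ :: _ :: _ :: _, e =>
    simp at e
    obtain ⟨rfl, rfl, rfl, rfl, rfl⟩ := e
    left; exact hr

theorem sublist_mid {a b t : Letter} {p s : List Letter} (hp : t ∉ p) (hs : t ∉ s)
    (hat : a ≠ t) (h : [a, t, b].Sublist (p ++ t :: s)) : a ∈ p ∧ [b].Sublist s := by
  have e2 : ∀ l : List Letter, [a, t].Sublist ([t] ++ l) → t ∈ l := fun l h => by
    rcases List.sublist_cons_iff.mp h with h | ⟨r, hr, -⟩
    · exact h.subset (by simp)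
    · exact absurd (List.cons.inj hr).1 hat
  rcases sublist_three h with h | ⟨h, -⟩ | ⟨h, h'⟩ | h
  · exact absurd (h.subset (by simp)) hp
  · exact absurd (h.subset (by simp)) hp
  · exact ⟨h, List.cons_sublist_cons.mp h'⟩
  · exact absurd (e2 s (List.Sublist.trans (by simp) h)) hs

/-- `t` is a simple letter of `w` lying between the first two occurrences of `a`. -/
def Sep (a t : Letter) (w : Word) : Prop :=
  IsSimple t w ∧ [a, t, a].Sublist w.toList ∧ ¬ [a, a, t].Sublist w.toList

theorem sublist_split {a t : Letter} {w : List Letter} (h : [a, t, a].Sublist w)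
    (ht : w.count t = 1) : ∃ p s, w = p ++ t :: s ∧ t ∉ p ∧ t ∉ s ∧ a ∈ p ∧ a ∈ s ∧ a ≠ t := by
  have hat : a ≠ t := by
    rintro rfl
    have := h.count_le a
    simp at this
    omega
  have htw : t ∈ w := List.count_pos_iff.mp (by omega)
  obtain ⟨p, s, rfl⟩ := List.append_of_mem htw
  rw [List.count_append, List.count_cons_self] at ht
  have hp : t ∉ p := List.count_eq_zero.mp (by omega)
  have hs : t ∉ s := List.count_eq_zero.mp (by omega)
  have h2 := sublist_mid hp hs hat h
  exact ⟨p, s, rfl, hp, hs, h2.1, List.singleton_sublist.mp h2.2, hat⟩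

theorem firstTwo_iff {a : Letter} {w : Word} (ha : IsMultiple a w) :
    FirstTwoInSameBlock a w ↔ ¬ ∃ t, Sep a t w := by
  unfold IsMultiple at ha
  constructor
  · rintro ⟨p, q, r, hw, hp, hq, hs⟩ ⟨t, h1, h2, h3⟩
    obtain ⟨p', s', hw', hp', hs', hap, has, hat⟩ := sublist_split h2 h1
    have htq : t ∉ q := fun h => hs t h h1
    have htw : t ∈ w.toList := by simp [hw']
    have h4 : [a, a, t].Sublist w.toList → False := h3
    have h5 := h2
    rw [hw] at h2 h4 htw
    have htr : t ∈ p ∨ t ∈ r := by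
      simp at htw
      tauto
    rcases htr with htp | htr
    · have hc : w.toList.count t = 1 := h1
      obtain ⟨p1, p2, rfl⟩ := List.append_of_mem htp
      have : p1.length = p'.length := by
        have e : p1 ++ t :: (p2 ++ a :: (q ++ a :: r)) = p' ++ t :: s' := by
          rw [← hw', hw]; simp
        have hc1 : t ∉ p1 := by
          intro hh
          rw [hw] at hc
          simp [List.count_append] at hc
          have := List.count_pos_iff.mpr hh
          omega
        have e' := congrArg (List.idxOf t) e
        simpa [List.idxOf_append_of_notMem, hc1, hp'] using e'
      have e : p1 ++ t :: (p2 ++ a :: (q ++ a :: r)) = p' ++ t :: s' := by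
        rw [← hw', hw]; simp
      have := (List.append_inj e this).1
      subst this
      exact hp (by simp [hap])
    · apply h4
      have : [a, a, t] = [] ++ a :: ([] ++ a :: [t]) := rfl
      rw [this]
      exact (List.nil_sublist p).append
        (((List.nil_sublist q).append ((List.singleton_sublist.mpr htr).cons_cons a)).cons_cons a)
  · intro h
    have h1 : a ∈ w.toList := List.count_pos_iff.mp (by omega)
    obtain ⟨p, s, hw, hp⟩ := List.eq_append_cons_of_mem h1
    have h2 : a ∈ s := by
      rw [hw, List.count_append, List.count_cons_self, List.count_eq_zero.mpr hp] at ha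
      exact List.count_pos_iff.mp (by omega)
    obtain ⟨q, r, rfl, hq⟩ := List.eq_append_cons_of_mem h2
    refine ⟨p, q, r, hw, hp, hq, fun t ht hst => h ⟨t, hst, ?_, ?_⟩⟩
    · rw [hw]
      have : [a, t, a] = [] ++ a :: ([t] ++ a :: []) := rfl
      rw [this]
      exact (List.nil_sublist p).append
        (((List.singleton_sublist.mpr ht).append ((List.nil_sublist r).cons_cons a)).cons_cons a)
    · intro hsub
      obtain ⟨q1, q2, rfl⟩ := List.append_of_mem ht
      have hc : w.toList.count t = 1 := hst
      have hat : a ≠ t := by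
        rintro rfl; simp at hq
      rw [hw] at hc hsub
      have e : p ++ a :: (q1 ++ t :: q2 ++ a :: r) = (p ++ a :: q1) ++ t :: (q2 ++ a :: r) := by
        simp
      rw [e] at hc hsub
      rw [List.count_append, List.count_cons_self] at hc
      have n2 : t ∉ q2 ++ a :: r := List.count_eq_zero.mp (by omega)
      have h3 : [a, a].Sublist (p ++ a :: q1) := by
        have n1 : t ∉ p ++ a :: q1 := List.count_eq_zero.mp (by omega)
        rcases sublist_three hsub with h | ⟨h, -⟩ | ⟨-, h⟩ | h
        · exact absurd (h.subset (by simp)) n1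
        · exact h
        · rcases List.sublist_cons_iff.mp h with h | ⟨r, hr, -⟩
          · exact absurd (h.subset (by simp)) n2
          · exact absurd (List.cons.inj hr).1 hat
        · rcases List.sublist_cons_iff.mp h with h | ⟨r, hr, -⟩
          · exact absurd (h.subset (by simp)) n2
          · exact absurd (List.cons.inj hr).1 hat
      have h4 := h3.count_le a
      have n3 : a ∉ q1 := fun hh => hq (by simp [hh])
      simp [List.count_append, List.count_eq_zero.mpr hp, List.count_eq_zero.mpr n3] at h4

theorem sep_transfer {u v : Word} (h : GammaRel u v) {a t t₁ : Letter} (ht : Sep a t u)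
    (ht₁ : Sep a t₁ v) : Sep a t v := by
  obtain ⟨h1, h2, h3⟩ := ht
  obtain ⟨k1, k2, k3⟩ := ht₁
  have hat : a ≠ t := by
    obtain ⟨_, _, _, _, _, _, _, hat⟩ := sublist_split h2 h1
    exact hat
  refine ⟨(h.1 t).mp h1, h.sublist (by simp [hat, hat.symm]) h2, fun hs => h3 ?_⟩
  obtain ⟨p, s, hv, hp, hs', hap, has, hat₁⟩ := sublist_split k2 k1
  have : [a, t].Sublist (t₁ :: s) := by
    rw [hv] at hs k3
    have h5 : ¬ [a, a].Sublist p := fun h5 =>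
      k3 (h5.append ((List.nil_sublist s).cons_cons t₁))
    rcases sublist_three hs with h | ⟨h, -⟩ | ⟨-, h⟩ | h
    · exact absurd (List.Sublist.trans (by simp) h) h5
    · exact absurd h h5
    · exact h
    · exact (List.sublist_cons_self _ _).trans h
  have h6 : [a, t].Sublist s := by
    rcases List.sublist_cons_iff.mp this with h | ⟨r, hr, -⟩
    · exact h
    · exact absurd (List.cons.inj hr).1 hat₁
  have h7 : [a, t₁, a, t].Sublist v.toList := by
    rw [hv]
    exact (List.singleton_sublist.mpr hap).append (h6.cons_cons t₁)
  have h8 := h.symm.sublist (by simp [hat, hat₁, hat₁.symm]) h7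
  refine List.Sublist.trans ?_ h8
  exact List.Sublist.cons_cons a (List.sublist_cons_self _ _)

theorem sep_multiple {a t : Letter} {w : Word} (h : Sep a t w) : IsMultiple a w := by
  obtain ⟨p, s, hw, _, _, hap, has, hat⟩ := sublist_split h.2.1 h.1
  unfold IsMultiple
  rw [hw, List.count_append, List.count_cons]
  have := List.count_pos_iff.mpr hap
  have := List.count_pos_iff.mpr has
  omega

theorem GammaRel.multiple_iff {u v : Word} (h : GammaRel u v) (a : Letter) :
    IsMultiple a u ↔ IsMultiple a v := by
  have := h.count_cases a
  unfold IsMultiple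
  omega

theorem betaRel_iff {u v : Word} :
    BetaRel u v ↔ GammaRel u v ∧ ∀ a t, Sep a t u ↔ Sep a t v := by
  constructor
  · rintro ⟨h, hb⟩
    refine ⟨h, fun a t => ⟨fun hs => ?_, fun hs => ?_⟩⟩
    · have hm := sep_multiple hs
      have := hb a hm
      rw [firstTwo_iff hm, firstTwo_iff ((h.multiple_iff a).mp hm), not_iff_not] at this
      obtain ⟨t₁, ht₁⟩ := this.mp ⟨t, hs⟩
      exact sep_transfer h hs ht₁
    · have hm := (h.multiple_iff a).mpr (sep_multiple hs)
      have := hb a hm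
      rw [firstTwo_iff hm, firstTwo_iff ((h.multiple_iff a).mp hm), not_iff_not] at this
      obtain ⟨t₁, ht₁⟩ := this.mpr ⟨t, hs⟩
      exact sep_transfer h.symm hs ht₁
  · rintro ⟨h, hb⟩
    refine ⟨h, fun a hm => ?_⟩
    rw [firstTwo_iff hm, firstTwo_iff ((h.multiple_iff a).mp hm), not_iff_not]
    simp only [hb]

theorem BetaRel.symm {u v : Word} (h : BetaRel u v) : BetaRel v u := by
  rw [betaRel_iff] at h ⊢
  exact ⟨h.1.symm, fun a t => (h.2 a t).symm⟩

theorem BetaRel.trans {u v w : Word} (h : BetaRel u v) (h' : BetaRel v w) : BetaRel u w := by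
  rw [betaRel_iff] at h h' ⊢
  exact ⟨h.1.trans h'.1, fun a t => (h.2 a t).trans (h'.2 a t)⟩

theorem sublist_pair_append {a t : Letter} {l m : List Letter} :
    [a, a, t].Sublist (l ++ m) ↔ [a, a, t].Sublist l ∨ ([a, a].Sublist l ∧ t ∈ m) ∨
      (a ∈ l ∧ [a, t].Sublist m) ∨ [a, a, t].Sublist m := by
  constructor
  · exact sublist_three
  · rintro (h | ⟨h, h'⟩ | ⟨h, h'⟩ | h)
    · exact h.trans (List.sublist_append_left _ _)
    · exact h.append (List.singleton_sublist.mpr h')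
    · exact (List.singleton_sublist.mpr h).append h'
    · exact h.trans (List.sublist_append_right _ _)

theorem two_sublist_iff {a : Letter} {l : List Letter} : [a, a].Sublist l ↔ 2 ≤ l.count a :=
  List.replicate_sublist_iff (n := 2)

theorem sep_mul_right {u v : Word} (h : GammaRel u v) (hb : ∀ a t, Sep a t u ↔ Sep a t v)
    (w : Word) (a t : Letter) (hs : Sep a t (u * w)) : Sep a t (v * w) := by
  have hγ : GammaRel (u * w) (v * w) := h.mul ⟨fun _ => Iff.rfl, rfl⟩
  obtain ⟨h1, h2, h3⟩ := hs
  have hat : a ≠ t := by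
    obtain ⟨_, _, _, _, _, _, _, hat⟩ := sublist_split h2 h1
    exact hat
  refine ⟨(hγ.1 t).mp h1, hγ.sublist (by simp [hat, hat.symm]) h2, fun hs => ?_⟩
  unfold IsSimple at h1
  have ca := h.count_cases a
  have ct := h.count_cases t
  have hma := h.mem_iff a
  simp only [FreeMonoid.toList_mul] at h1 h2 h3 hs
  rw [sublist_pair_append] at h3 hs
  push Not at h3
  obtain ⟨n1, n2, n3, n4⟩ := h3
  rcases hs with hs | ⟨hs, hs'⟩ | ⟨hs, hs'⟩ | hs
  · have htv : t ∈ v.toList := hs.subset (by simp)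
    have htu := (h.mem_iff t).mpr htv
    have htu' := List.count_pos_iff.mpr htu
    rw [List.count_append] at h1
    have htw : t ∉ w.toList := List.count_eq_zero.mp (by omega)
    have hav : 2 ≤ v.toList.count a := by
      have := hs.count_le a
      simp [hat.symm] at this
      omega
    have hau : [a, a].Sublist u.toList := two_sublist_iff.mpr (by omega)
    obtain ⟨p, s, hu, hp, hs2⟩ : ∃ p s, u.toList = p ++ t :: s ∧ t ∉ p ∧ t ∉ s := by
      obtain ⟨p, s, hu⟩ := List.append_of_mem htu
      rw [hu, List.count_append, List.count_cons_self] at h1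
      exact ⟨p, s, hu, List.count_eq_zero.mp (by omega), List.count_eq_zero.mp (by omega)⟩
    have hap : a ∈ p := by
      rw [hu, List.append_assoc, List.cons_append] at h2
      exact (sublist_mid hp (by simp [hs2, htw]) hat h2).1
    have has : a ∈ s := by
      by_contra has
      apply n1
      rw [hu]
      have : 2 ≤ p.count a := by
        have h9 := two_sublist_iff.mp hau
        rw [hu, List.count_append, List.count_cons, List.count_eq_zero.mpr has] at h9
        simpa [hat.symm] using h9
      exact (two_sublist_iff.mpr this).append ((List.nil_sublist s).cons_cons t)
    have hsep : Sep a t u := by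
      refine ⟨by unfold IsSimple; omega, ?_, n1⟩
      rw [hu]
      exact (List.singleton_sublist.mpr hap).append ((List.singleton_sublist.mpr has).cons_cons t)
    exact ((hb a t).mp hsep).2.2 hs
  · rw [two_sublist_iff] at hs
    exact n2 (two_sublist_iff.mpr (by omega)) hs'
  · exact n3 (hma.mpr hs) hs'
  · exact n4 hs

theorem sep_mul_left {u v : Word} (h : GammaRel u v) (hb : ∀ a t, Sep a t u ↔ Sep a t v)
    (w : Word) (a t : Letter) (hs : Sep a t (w * u)) : Sep a t (w * v) := by
  have hγ : GammaRel (w * u) (w * v) := GammaRel.mul ⟨fun _ => Iff.rfl, rfl⟩ h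
  obtain ⟨h1, h2, h3⟩ := hs
  have hat : a ≠ t := by
    obtain ⟨_, _, _, _, _, _, _, hat⟩ := sublist_split h2 h1
    exact hat
  refine ⟨(hγ.1 t).mp h1, hγ.sublist (by simp [hat, hat.symm]) h2, fun hs => ?_⟩
  unfold IsSimple at h1
  have ct := h.count_cases t
  have hmt := h.mem_iff t
  have hsub : [a, t].Sublist v.toList → [a, t].Sublist u.toList := h.symm.sublist (by simp [hat])
  simp only [FreeMonoid.toList_mul] at h1 h2 h3 hs
  rw [sublist_pair_append] at h3 hs
  push Not at h3
  obtain ⟨n1, n2, n3, n4⟩ := h3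
  rcases hs with hs | ⟨hs, hs'⟩ | ⟨hs, hs'⟩ | hs
  · exact n1 hs
  · exact n2 hs (hmt.mpr hs')
  · exact n3 hs (hsub hs')
  · have hat' : [a, t].Sublist u.toList := hsub ((List.sublist_cons_self _ _).trans hs)
    have haw : a ∉ w.toList := fun hh => n3 hh hat'
    have htu := List.count_pos_iff.mpr (hmt.mpr (hs.subset (by simp)))
    rw [List.count_append] at h1
    have hsep : Sep a t u := by
      refine ⟨by unfold IsSimple; omega, ?_, n4⟩
      rcases sublist_three h2 with h | ⟨h, -⟩ | ⟨h, -⟩ | h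
      · exact absurd (h.subset (by simp)) haw
      · exact absurd (h.subset (by simp)) haw
      · exact absurd h haw
      · exact h
    exact ((hb a t).mp hsep).2.2 hs

theorem BetaRel.mul {u v u' v' : Word} (h : BetaRel u v) (h' : BetaRel u' v') :
    BetaRel (u * u') (v * v') := by
  have r : ∀ {a b : Word}, BetaRel a b → ∀ c, BetaRel (a * c) (b * c) := by
    intro a b hab c
    have hba := hab.symm
    rw [betaRel_iff] at hab hba ⊢
    exact ⟨hab.1.mul ⟨fun _ => Iff.rfl, rfl⟩, fun d t =>
      ⟨sep_mul_right hab.1 hab.2 c d t, sep_mul_right hba.1 hba.2 c d t⟩⟩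
  have l : ∀ {a b : Word}, BetaRel a b → ∀ c, BetaRel (c * a) (c * b) := by
    intro a b hab c
    have hba := hab.symm
    rw [betaRel_iff] at hab hba ⊢
    exact ⟨GammaRel.mul ⟨fun _ => Iff.rfl, rfl⟩ hab.1, fun d t =>
      ⟨sep_mul_left hab.1 hab.2 c d t, sep_mul_left hba.1 hba.2 c d t⟩⟩
  exact (r h u').trans (l h' v)

/-- The congruence `β` on the free monoid. -/
def beta : Con Word where
  r := BetaRel
  iseqv := ⟨fun _ => ⟨⟨fun _ => Iff.rfl, rfl⟩, fun _ _ => Iff.rfl⟩, BetaRel.symm, BetaRel.trans⟩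
  mul' := BetaRel.mul

open FreeMonoid in
/-- The word `a_{0,k}[π] = x (z_{1π} y_1² z_{2π} y_2² ⋯ y_{k-1}² z_{kπ}) x (t_1 z_1 ⋯ t_k z_k)`,
with the indices `1, …, k` shifted to `0, …, k - 1`. -/
def a0 (k : ℕ) (π : Equiv.Perm (Fin k)) : Word :=
  of Letter.x *
    (List.ofFn fun i : Fin k =>
      of (Letter.z (π i)) * (if (i : ℕ) + 1 < k then of (Letter.y i) ^ 2 else 1)).prod *
  of Letter.x *
    (List.ofFn fun i : Fin k => of (Letter.t i) * of (Letter.z i)).prod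

end Word

/-! ### Rees quotients and the monoids `M_α(W)` -/

/-- The Rees congruence of a two-sided ideal `I` of a monoid: it collapses `I` to a point. -/
def reesCon {M : Type*} [Monoid M] (I : Set M)
    (hl : ∀ a, ∀ b ∈ I, a * b ∈ I) (hr : ∀ a ∈ I, ∀ b, a * b ∈ I) : Con M where
  r a b := a = b ∨ (a ∈ I ∧ b ∈ I)
  iseqv := by
    refine ⟨fun _ => Or.inl rfl, ?_, ?_⟩
    · rintro a b (rfl | ⟨h, h'⟩)
      · exact Or.inl rfl
      · exact Or.inr ⟨h', h⟩
    · rintro a b c (rfl | ⟨h, h'⟩) (rfl | ⟨k, k'⟩)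
      · exact Or.inl rfl
      · exact Or.inr ⟨k, k'⟩
      · exact Or.inr ⟨h, h'⟩
      · exact Or.inr ⟨h, k'⟩
  mul' := by
    rintro a b c d (rfl | ⟨h, h'⟩) (rfl | ⟨k, k'⟩)
    · exact Or.inl rfl
    · exact Or.inr ⟨hl _ _ k, hl _ _ k'⟩
    · exact Or.inr ⟨hr _ h _, hr _ h' _⟩
    · exact Or.inr ⟨hr _ h _, hr _ h' _⟩

/-- The closure of a set `W` of elements of a monoid under taking factors. -/
def factorClosure {M : Type*} [Monoid M] (W : Set M) : Set M :=
  {c | ∃ w ∈ W, ∃ p s, w = p * c * s}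

/-- The congruence on `X*/α` whose quotient is `M_α(W)`: the Rees congruence of the ideal of all
`α`-classes that are not factors of any `α`-class in `W`. -/
def sapirCon (α : Con Word) (W : Set α.Quotient) : Con α.Quotient :=
  reesCon (factorClosure W)ᶜ
    (by
      rintro a b hb ⟨w, hw, p, s, h⟩
      exact hb ⟨w, hw, p * a, s, by rw [h]; simp only [mul_assoc]⟩)
    (by
      rintro a ha b ⟨w, hw, p, s, h⟩
      exact ha ⟨w, hw, p, b * s, by rw [h]; simp only [mul_assoc]⟩)

/-- The monoid `M_α(W)`. -/
abbrev SapirMonoid (α : Con Word) (W : Set α.Quotient) : Type := (sapirCon α W).Quotient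

/-! ### Varieties of monoids -/

/-- An identity `u ≈ v`, where `u` and `v` are words. -/
abbrev MonoidIdentity : Type := Word × Word

/-- The monoid `M` satisfies the identity `e`: every substitution of elements of `M` for the
letters gives both sides of `e` the same value. -/
def Satisfies (M : Type*) [Monoid M] (e : MonoidIdentity) : Prop :=
  ∀ φ : Letter → M, FreeMonoid.lift φ e.1 = FreeMonoid.lift φ e.2

/-- A variety of monoids: the class of all monoids satisfying some set of identities. -/
@[ext]
structure MonoidVariety where
  carrier : Set MonCat.{u}
  exists_identities : ∃ E : Set MonoidIdentity, carrier = {M : MonCat.{u} | ∀ e ∈ E, Satisfies M e}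

namespace MonoidVariety

/-- The variety given by a set of identities. -/
def ofIdentities (E : Set MonoidIdentity) : MonoidVariety.{u} :=
  ⟨{M : MonCat.{u} | ∀ e ∈ E, Satisfies M e}, E, rfl⟩

/-- The set of all identities that hold in every monoid of the variety. -/
def identities (V : MonoidVariety.{u}) : Set MonoidIdentity :=
  {e | ∀ M ∈ V.carrier, Satisfies M e}

/-- Varieties are ordered by inclusion. -/
instance : PartialOrder MonoidVariety.{u} :=
  PartialOrder.lift carrier (fun _ _ h => MonoidVariety.ext h)

theorem le_ofIdentities_iff {V : MonoidVariety.{u}} {E : Set MonoidIdentity} :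
    V ≤ ofIdentities E ↔ E ⊆ V.identities :=
  ⟨fun h e he _ hM => h hM e he, fun h M hM _ he => h he M hM⟩

theorem ofIdentities_identities (V : MonoidVariety.{u}) : ofIdentities V.identities = V := by
  obtain ⟨c, E, rfl⟩ := V
  refine le_antisymm (fun _ hM e he => hM e fun _ hN => hN e he) ?_
  exact le_ofIdentities_iff.mpr subset_rfl

/-- The lattice of varieties: the meet is the intersection, and the join is the variety given by
the identities that hold in both varieties. -/
instance : Lattice MonoidVariety.{u} where
  inf V W := ⟨V.carrier ∩ W.carrier, by
    obtain ⟨E, hE⟩ := V.exists_identities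
    obtain ⟨F, hF⟩ := W.exists_identities
    refine ⟨E ∪ F, ?_⟩
    rw [hE, hF]
    ext M
    simp only [Set.mem_inter_iff, Set.mem_ofPred_eq, Set.mem_union, or_imp, forall_and]⟩
  sup V W := ofIdentities (V.identities ∩ W.identities)
  inf_le_left _ _ := Set.inter_subset_left
  inf_le_right _ _ := Set.inter_subset_right
  le_inf _ _ _ h h' := Set.subset_inter h h'
  le_sup_left _ _ := le_ofIdentities_iff.mpr Set.inter_subset_left
  le_sup_right _ _ := le_ofIdentities_iff.mpr Set.inter_subset_right
  sup_le V W U h h' := by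
    rw [← ofIdentities_identities U, le_ofIdentities_iff] at h h'
    intro M hM
    rw [← ofIdentities_identities U]
    exact fun e he => hM e ⟨h he, h' he⟩

/-- The variety generated by a monoid. -/
def generatedBy (M : Type v) [Monoid M] : MonoidVariety.{u} :=
  ofIdentities {e | Satisfies M e}

theorem isLeast_generatedBy (M : Type u) [Monoid M] :
    IsLeast {V : MonoidVariety.{u} | MonCat.of M ∈ V.carrier} (generatedBy M) := by
  refine ⟨fun e he => he, fun V hV => ?_⟩
  rw [← ofIdentities_identities V]
  exact fun N hN e he => hN e (he _ hV)

/-- The lattice of subvarieties of a variety, ordered by inclusion. -/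
abbrev Subvarieties (V : MonoidVariety.{u}) : Type _ := Set.Iic V

/-- A variety is distributive if its lattice of subvarieties is distributive. -/
def IsDistributive (V : MonoidVariety.{u}) : Prop :=
  ∀ X Y Z : V.Subvarieties, X ⊓ (Y ⊔ Z) = (X ⊓ Y) ⊔ (X ⊓ Z)

end MonoidVariety

/-! ### Images of words under substitutions -/

namespace Word

/-! Write $k=m+2$. In $\mathbf a_{0,k}[\pi]$ the first $z$-letter of the block is replaced by three
letters $f_0,f_1,f_2$ and the last one by $l_0,l_1,l_2$. In the tail these letters recur in the
orders $f_0,f_2,f_1$ and $l_1,l_0,l_2$, separated by simple letters. Let $w_{pq}$ be the resulting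
word, where $p$ inserts an $x$ after $f_0$ in the block and $q$ inserts an $x$ before $l_2$. Inside
the given variety let $X,Y,Z$ be defined by $w_{01}\approx w_{10}$, $w_{00}\approx w_{01}$,
$w_{00}\approx w_{10}$. Any two of these identities imply the third, so $(X\wedge Y)\vee(X\wedge Z)$
satisfies $w_{00}\approx w_{01}$. It remains to find a monoid in $X\wedge(Y\vee Z)$ that violates
it.

Such monoids are syntactic monoids of languages given by tests. A test is a substitution with a
context, and a word passes if its image lies in the $\beta$-class of $\mathbf a_{0,k}[\pi]$.
Identities of $M_\beta$ preserve the result of every test (`Test.passes_congr`), so these syntactic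
monoids lie in the variety. The monoids for `lastTests`, `firstTests` and their union are placed in
$Y$, $Z$ and $X\wedge(Y\vee Z)$. The union belongs to the join because its language is an
intersection (`satisfies_syntacticCon_union`).

The core is the dichotomy `InClass.flat_or_spanning`. If the image of $w_{pq}$ is a factor of the
class, then either the stretch from $x$ to $x$ collapses to a power of one letter (or $x$ is
erased), and inserted $x$'s are invisible; or it covers the whole block of $\mathbf a_{0,k}[\pi]$,
with $z_{0\pi}$ coming from some $f_i$ and the last $z$-letter from some $l_j$ (indices start at
$0$). In the second case an $x$ inserted on the wrong side of $f_i$ or $l_j$ is fatal, and one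
inserted on the outer side only changes an exponent of $x$.

Selection tests keep one $f_i$ and one $l_j$. Further tests (`negTest`, `posTest`) read off the
order of occurrences and thereby fix which letters can play the roles of the $f_i$ and $l_j$. Each
of the sets `lastTests` and `firstTests` makes its own insertion harmless (`lastTests_congr`,
`firstTests_congr`). Their union rigidifies a whole triple, so a substitution instance of $w_{pq}$
with an insertion passes only if everything is flat (`all_flat_of_true`). Hence $w_{01}\approx
w_{10}$ holds there, but $w_{00}$ passes and $w_{01}$ does not. -/

theorem toList_lift (φ : Letter → Word) (w : Word) :
    (FreeMonoid.lift φ w).toList = w.toList.flatMap fun l => (φ l).toList := by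
  rw [FreeMonoid.lift_apply, FreeMonoid.toList_prod, List.map_map, List.flatMap_def]
  rfl

theorem sublist_flatMap_of_forall₂ {α β : Type*} {g : α → List β} {ds : List β} {us X : List α}
    (h : List.Forall₂ (fun d u => d ∈ g u) ds us) (hs : us.Sublist X) :
    ds.Sublist (X.flatMap g) := by
  refine List.Sublist.trans ?_ (hs.flatMap g)
  induction h with
  | nil => simp
  | cons h _ ih =>
    exact (List.singleton_sublist.mpr h).append (ih ((List.sublist_cons_self _ _).trans hs))

/-! ### The islands of `a0 k π` and their positions -/

/-- The position in the first block of `a0 k π` of the occurrence of `z n`. -/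
def pos {k : ℕ} (π : Equiv.Perm (Fin k)) (n : ℕ) : ℕ :=
  -- The value 0 for `n ≥ k` is never used: `HasRank` requires `n < k` for `z n`.
  if h : n < k then π.symm ⟨n, h⟩ else 0

theorem pos_lt {k : ℕ} (π : Equiv.Perm (Fin k)) {n : ℕ} (h : n < k) : pos π n < k := by
  simp [pos, h]

theorem pos_apply {k : ℕ} (π : Equiv.Perm (Fin k)) (i : Fin k) : pos π (π i) = i := by
  simp [pos]

/-- The letter `l` stands at the place number `r` of `a0 k π`. -/
def HasRank {k : ℕ} (π : Equiv.Perm (Fin k)) (l : Letter) (r : ℕ) : Prop :=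
  -- Each step of the block takes three places: `z (π i)` at `3 * i + 1`, then the square of `y i`.
  -- The last `z`-letter, at `3 * k - 2`, has no square after it, so the second `x` is at `3 * k -
  -- 1` and the tail starts at `3 * k`.
  match l with
  | .x => r = 0 ∨ r = 3 * k - 1
  | .y n => n + 1 < k ∧ (r = 3 * n + 2 ∨ r = 3 * n + 3)
  | .z n => n < k ∧ (r = 3 * pos π n + 1 ∨ r = 3 * k + 2 * n + 1)
  | .t n => n < k ∧ r = 3 * k + 2 * n

/-- The letters of `a0 k π` together with their places. -/
def rankedList {k : ℕ} (π : Equiv.Perm (Fin k)) : List (Letter × ℕ) :=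
  (.x, 0) :: (List.ofFn fun i : Fin k => (Letter.z (π i), 3 * (i : ℕ) + 1) ::
      if (i : ℕ) + 1 < k then [(Letter.y i, 3 * (i : ℕ) + 2), (Letter.y i, 3 * (i : ℕ) + 3)]
      else []).flatten ++
    (.x, 3 * k - 1) ::
      (List.ofFn fun i : Fin k => [(Letter.t i, 3 * k + 2 * (i : ℕ)),
        (Letter.z i, 3 * k + 2 * (i : ℕ) + 1)]).flatten

theorem map_fst_rankedList {k : ℕ} (π : Equiv.Perm (Fin k)) :
    (rankedList π).map Prod.fst = (a0 k π).toList := by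
  simp only [rankedList, a0, FreeMonoid.toList_mul, FreeMonoid.toList_of, FreeMonoid.toList_prod,
    List.map_ofFn, List.map_append, List.map_cons, List.map_flatten, List.cons_append,
    List.nil_append, List.append_assoc]
  refine congrArg (Letter.x :: ·) (congrArg₂ (· ++ ·)
    (congrArg List.flatten (congrArg List.ofFn (funext fun i => ?_)))
    (congrArg (Letter.x :: ·) (congrArg List.flatten (congrArg List.ofFn (funext fun i => ?_)))))
  · by_cases h : (i : ℕ) + 1 < k <;> simp [h, pow_two]
  · simp

theorem mem_rankedList {k : ℕ} (π : Equiv.Perm (Fin k)) (l : Letter) (r : ℕ) :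
    (l, r) ∈ rankedList π ↔ HasRank π l r := by
  simp only [rankedList, List.cons_append, List.mem_cons, List.mem_append, List.mem_flatten,
    List.mem_ofFn, Prod.mk.injEq]
  constructor
  · rintro (⟨rfl, rfl⟩ | ⟨_, ⟨i, rfl⟩, h⟩ | ⟨rfl, rfl⟩ | ⟨_, ⟨i, rfl⟩, h⟩)
    · exact Or.inl rfl
    · rcases List.mem_cons.mp h with h | h
      · obtain ⟨rfl, rfl⟩ := Prod.mk.inj h
        exact ⟨(π i).2, Or.inl (by rw [pos_apply])⟩
      · split_ifs at h with hi
        · simp only [List.mem_cons, Prod.mk.injEq, List.not_mem_nil, or_false] at h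
          rcases h with ⟨rfl, rfl⟩ | ⟨rfl, rfl⟩
          · exact ⟨hi, Or.inl rfl⟩
          · exact ⟨hi, Or.inr rfl⟩
        · simp at h
    · exact Or.inr rfl
    · simp only [List.mem_cons, Prod.mk.injEq, List.not_mem_nil, or_false] at h
      rcases h with ⟨rfl, rfl⟩ | ⟨rfl, rfl⟩
      · exact ⟨i.2, rfl⟩
      · exact ⟨i.2, Or.inr rfl⟩
  · intro h
    match l, h with
    | .x, .inl h => exact Or.inl ⟨rfl, h⟩
    | .x, .inr h => exact Or.inr (Or.inr (Or.inl ⟨rfl, h⟩))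
    | .y n, ⟨hn, h⟩ =>
      refine Or.inr (Or.inl ⟨_, ⟨⟨n, by omega⟩, rfl⟩, List.mem_cons_of_mem _ ?_⟩)
      rw [if_pos hn]
      rcases h with rfl | rfl <;> simp
    | .z n, ⟨hn, .inl h⟩ =>
      refine Or.inr (Or.inl ⟨_, ⟨π.symm ⟨n, hn⟩, rfl⟩, List.mem_cons.mpr (Or.inl ?_)⟩)
      simp [h, pos, hn]
    | .z n, ⟨hn, .inr h⟩ =>
      exact Or.inr (Or.inr (Or.inr ⟨_, ⟨⟨n, hn⟩, rfl⟩, by simp [h]⟩))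
    | .t n, ⟨hn, h⟩ =>
      exact Or.inr (Or.inr (Or.inr ⟨_, ⟨⟨n, hn⟩, rfl⟩, by simp [h]⟩))

theorem pairwise_rankedList {k : ℕ} (hk : 2 ≤ k) (π : Equiv.Perm (Fin k)) :
    (rankedList π).Pairwise fun p q => p.2 < q.2 := by
  have e1 : ∀ i : Fin k, ∀ p : Letter × ℕ, p ∈ ((Letter.z (π i), 3 * (i : ℕ) + 1) ::
      if (i : ℕ) + 1 < k then [(Letter.y i, 3 * (i : ℕ) + 2), (Letter.y i, 3 * (i : ℕ) + 3)]
      else []) → 3 * (i : ℕ) + 1 ≤ p.2 ∧ p.2 ≤ 3 * (i : ℕ) + 3 ∧ p.2 < 3 * k - 1 := by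
    intro i p hp
    have := i.2
    split_ifs at hp with hi
    · simp only [List.mem_cons, List.not_mem_nil, or_false] at hp
      rcases hp with rfl | rfl | rfl <;> dsimp only <;> omega
    · simp only [List.mem_cons, List.not_mem_nil, or_false] at hp
      subst hp
      dsimp only; omega
  have e2 : ∀ i : Fin k, ∀ p : Letter × ℕ, p ∈ [(Letter.t i, 3 * k + 2 * (i : ℕ)),
        (Letter.z i, 3 * k + 2 * (i : ℕ) + 1)] →
        3 * k + 2 * (i : ℕ) ≤ p.2 ∧ p.2 ≤ 3 * k + 2 * (i : ℕ) + 1 := by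
    intro i p hp
    simp only [List.mem_cons, List.not_mem_nil, or_false] at hp
    rcases hp with rfl | rfl <;> dsimp only <;> omega
  unfold rankedList
  rw [List.pairwise_append, List.pairwise_cons, List.pairwise_cons, List.pairwise_flatten,
    List.pairwise_flatten]
  simp only [List.mem_flatten, List.mem_ofFn, List.pairwise_ofFn, List.mem_cons]
  refine ⟨⟨?_, ?_, ?_⟩, ⟨?_, ?_, ?_⟩, ?_⟩
  · rintro p ⟨_, ⟨i, rfl⟩, h⟩
    have := e1 i p h
    omega
  · rintro _ ⟨i, rfl⟩
    split_ifs <;> simp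
  · intro i j hij p hp q hq
    have h1 := e1 i p (by simpa using hp)
    have h2 := e1 j q (by simpa using hq)
    have : (i : ℕ) < j := hij
    omega
  · rintro p ⟨_, ⟨i, rfl⟩, h⟩
    have := e2 i p h
    omega
  · rintro _ ⟨i, rfl⟩
    simp
  · intro i j hij p hp q hq
    have h1 := e2 i p (by simpa using hp)
    have h2 := e2 j q (by simpa using hq)
    have : (i : ℕ) < j := hij
    omega
  · rintro p (rfl | ⟨_, ⟨i, rfl⟩, h⟩) q (rfl | ⟨_, ⟨j, rfl⟩, h'⟩)
    · dsimp only; omega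
    · have := e2 j q h'
      dsimp only; omega
    · have := e1 i p h
      dsimp only; omega
    · have := e2 j q h'
      have := e1 i p h
      omega

/-- The letters of `ls` stand at increasing places of `a0 k π`, all of them at least `b`. -/
def Ranked {k : ℕ} (π : Equiv.Perm (Fin k)) : ℕ → List Letter → Prop
  | _, [] => True
  | b, l :: ls => ∃ r, b ≤ r ∧ HasRank π l r ∧ Ranked π (r + 1) ls

theorem ranked_of_pairwise {k : ℕ} (π : Equiv.Perm (Fin k)) (R : List (Letter × ℕ)) (b : ℕ)
    (h1 : ∀ p ∈ R, HasRank π p.1 p.2 ∧ b ≤ p.2) (h2 : R.Pairwise fun p q => p.2 < q.2) :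
    Ranked π b (R.map Prod.fst) := by
  induction R generalizing b with
  | nil => trivial
  | cons p R ih =>
    rw [List.pairwise_cons] at h2
    exact ⟨p.2, (h1 p (by simp)).2, (h1 p (by simp)).1,
      ih _ (fun q hq => ⟨(h1 q (by simp [hq])).1, h2.1 q hq⟩) h2.2⟩

theorem exists_of_ranked {k : ℕ} (π : Equiv.Perm (Fin k)) (l : List Letter) (b : ℕ)
    (h : Ranked π b l) : ∃ R : List (Letter × ℕ), R.map Prod.fst = l ∧
      (∀ p ∈ R, HasRank π p.1 p.2 ∧ b ≤ p.2) ∧ R.Pairwise fun p q => p.2 < q.2 := by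
  induction l generalizing b with
  | nil => exact ⟨[], by simp⟩
  | cons a l ih =>
    obtain ⟨r, hb, hr, h⟩ := h
    obtain ⟨R, rfl, h1, h2⟩ := ih _ h
    refine ⟨(a, r) :: R, rfl, ?_, List.pairwise_cons.mpr ⟨fun q hq => (h1 q hq).2, h2⟩⟩
    intro p hp
    rcases List.mem_cons.mp hp with rfl | hp
    · exact ⟨hr, hb⟩
    · exact ⟨(h1 p hp).1, by have := (h1 p hp).2; omega⟩

/-- The places increase strictly along the word, so a sublist is the same as an increasing choice of
places. Questions about subsequences of `a0 k π` thus become linear arithmetic. -/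
theorem sublist_a0_iff {k : ℕ} (hk : 2 ≤ k) (π : Equiv.Perm (Fin k)) (l : List Letter) :
    l.Sublist (a0 k π).toList ↔ Ranked π 0 l := by
  have hp := pairwise_rankedList hk π
  rw [← map_fst_rankedList]
  constructor
  · intro h
    obtain ⟨R, hR, rfl⟩ := List.sublist_map_iff.mp h
    exact ranked_of_pairwise π R 0
      (fun p h => ⟨(mem_rankedList π _ _).mp (hR.subset h), Nat.zero_le _⟩) (hp.sublist hR)
  · intro h
    obtain ⟨R, rfl, h1, h2⟩ := exists_of_ranked π l 0 h
    refine List.Sublist.map _ ?_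
    have hr : ∀ p ∈ R, p ∈ rankedList π := fun p h => (mem_rankedList π _ _).mpr (h1 p h).1
    have : Std.Antisymm fun p q : Letter × ℕ => p.2 < q.2 := ⟨fun p q h h' => by omega⟩
    refine List.sublist_of_subperm_of_pairwise (List.subperm_of_subset ?_ hr) h2 hp
    exact h2.imp fun h e => by subst e; omega
/-! ### Changing exponents inside a `β`-class -/

theorem destutter_replicate (c : Letter) (n : ℕ) :
    (List.replicate (n + 1) c).destutter (· ≠ ·) = [c] := by
  rw [List.replicate_succ, List.destutter_cons']
  induction n with
  | zero => rfl
  | succ n ih => rw [List.replicate_succ, List.destutter'_cons_neg _ (by simp), ih]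

/-- With exponents at least 2 neither power has a simple letter, so nothing can separate
occurrences. -/
theorem betaRel_replicate (c : Letter) {m n : ℕ} (hm : 2 ≤ m) (hn : 2 ≤ n) :
    BetaRel (FreeMonoid.ofList (List.replicate m c)) (FreeMonoid.ofList (List.replicate n c)) := by
  have hs : ∀ (m : ℕ), 2 ≤ m → ∀ a,
      ¬ IsSimple a (FreeMonoid.ofList (List.replicate m c)) := by
    intro m hm a h
    simp only [IsSimple, FreeMonoid.toList_ofList, List.count_replicate] at h
    split_ifs at h
    omega
  rw [betaRel_iff]
  refine ⟨⟨fun a => iff_of_false (hs m hm a) (hs n hn a), ?_⟩,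
    fun a t => iff_of_false (fun h => hs m hm t h.1) fun h => hs n hn t h.1⟩
  obtain ⟨m, rfl⟩ := Nat.exists_eq_add_of_le' hm
  obtain ⟨n, rfl⟩ := Nat.exists_eq_add_of_le' hn
  exact (destutter_replicate c _).trans (destutter_replicate c _).symm

theorem sublist_iff_filter {l w : List Letter} {e : Letter} (he : e ∉ l) :
    l.Sublist w ↔ l.Sublist (w.filter (· ≠ e)) := by
  constructor
  · intro h
    have := h.filter (· ≠ e)
    rwa [List.filter_eq_self.mpr] at this
    intro a ha
    simp only [decide_eq_true_eq]
    rintro rfl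
    exact he ha
  · exact fun h => h.trans List.filter_sublist

/-- Since `e` occurs elsewhere, doubling one occurrence creates or destroys no simple letter.
Separation of the occurrences of `e` is excluded by hypothesis. For any other letter it can be read
after deleting `e`. -/
theorem betaRel_double {P Q : List Letter} {e : Letter} (he : e ∈ P ∨ e ∈ Q)
    (hno : ∀ t, (P ++ [e, e] ++ Q).count t = 1 → ¬ [e, t, e].Sublist (P ++ [e, e] ++ Q)) :
    BetaRel (FreeMonoid.ofList (P ++ [e] ++ Q)) (FreeMonoid.ofList (P ++ [e, e] ++ Q)) := by
  have he' : 0 < P.count e ∨ 0 < Q.count e := by simpa [List.count_pos_iff] using he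
  have hγ : GammaRel (FreeMonoid.ofList (P ++ [e] ++ Q))
      (FreeMonoid.ofList (P ++ [e, e] ++ Q)) := by
    constructor
    · intro a
      by_cases ha : a = e
      · subst ha
        simp only [IsSimple, FreeMonoid.toList_ofList, List.count_append, List.count_cons_self,
          List.count_nil]
        omega
      · have ha' : ¬ e = a := fun h => ha h.symm
        simp [IsSimple, List.count_append, ha']
    · refine destutter_append_congr (destutter_append_congr rfl ?_) rfl
      simp
  have hmul : ∀ a, IsSimple a (FreeMonoid.ofList (P ++ [e] ++ Q)) → a ≠ e := by
    rintro a h rfl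
    simp only [IsSimple, FreeMonoid.toList_ofList, List.count_append, List.count_cons_self,
          List.count_nil] at h
    omega
  rw [betaRel_iff]
  refine ⟨hγ, fun a t => ?_⟩
  have hsub : (P ++ [e] ++ Q).Sublist (P ++ [e, e] ++ Q) :=
    ((List.Sublist.refl P).append (by simp)).append (List.Sublist.refl Q)
  by_cases ha : a = e
  · subst ha
    exact iff_of_false (fun h => hno t ((hγ.1 t).mp h.1) (h.2.1.trans hsub))
      fun h => hno t h.1 h.2.1
  · by_cases ht : IsSimple t (FreeMonoid.ofList (P ++ [e] ++ Q))
    · by_cases hat : a = t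
      · subst hat
        exact iff_of_false (fun h => h.2.2 h.2.1) fun h => h.2.2 h.2.1
      have hc : [a, t, a].IsChain (· ≠ ·) := by simp [hat, Ne.symm hat]
      have hte := hmul t ht
      have hn : e ∉ [a, a, t] := by simp [Ne.symm ha, hte.symm]
      have h1 : [a, a, t].Sublist (P ++ [e] ++ Q) ↔ [a, a, t].Sublist (P ++ [e, e] ++ Q) := by
        rw [sublist_iff_filter hn, sublist_iff_filter (w := P ++ [e, e] ++ Q) hn]
        simp
      exact and_congr (hγ.1 t) (and_congr ⟨hγ.sublist hc, hγ.symm.sublist hc⟩ (not_congr h1))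
    · exact iff_of_false (fun h => ht h.1) fun h => ht ((hγ.1 t).mpr h.1)

/-! ### The `β`-class of `a0 k π` -/

/-- The list `l` is a word in the `β`-class of `a0 k π`. -/
def InClass {k : ℕ} (π : Equiv.Perm (Fin k)) (l : List Letter) : Prop :=
  BetaRel (FreeMonoid.ofList l) (a0 k π)

section
variable {k : ℕ} {π : Equiv.Perm (Fin k)} {l : List Letter}

theorem InClass.ranked (hk : 2 ≤ k) (h : InClass π l) {ls : List Letter} (hs : ls.Sublist l)
    (hc : ls.IsChain (· ≠ ·)) : Ranked π 0 ls :=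
  (sublist_a0_iff hk π ls).mp (GammaRel.sublist h.1 hc hs)

theorem InClass.sublist (hk : 2 ≤ k) (h : InClass π l) {ls : List Letter} (hs : Ranked π 0 ls)
    (hc : ls.IsChain (· ≠ ·)) : ls.Sublist l :=
  GammaRel.sublist h.1.symm hc ((sublist_a0_iff hk π ls).mpr hs)

theorem isSimple_t (hk : 2 ≤ k) {n : ℕ} (hn : n < k) : IsSimple (.t n) (a0 k π) := by
  have h1 : 1 ≤ (a0 k π).toList.count (.t n) := by
    rw [Nat.one_le_iff_ne_zero, ← Nat.pos_iff_ne_zero, List.count_pos_iff,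
      ← List.singleton_sublist, sublist_a0_iff hk]
    simp [Ranked, HasRank, hn]
  have h2 : ¬ [.t n, .t n].Sublist (a0 k π).toList := by
    rw [sublist_a0_iff hk]
    simp only [Ranked, HasRank]
    rintro ⟨r, -, h, s, h', h'', -⟩
    omega
  rw [two_sublist_iff] at h2
  unfold IsSimple
  omega

theorem not_isSimple_of_rank (hk : 2 ≤ k) {a : Letter} {r : ℕ} (h : HasRank π a r)
    (hr : r < 3 * k - 1) : ¬ IsSimple a (a0 k π) := by
  suffices [a, a].Sublist (a0 k π).toList by
    rw [two_sublist_iff] at this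
    unfold IsSimple
    omega
  rw [sublist_a0_iff hk]
  match a, h with
  | .x, _ => exact ⟨0, le_rfl, Or.inl rfl, 3 * k - 1, by omega, Or.inr rfl, trivial⟩
  | .y n, h => exact ⟨_, Nat.zero_le _, ⟨h.1, Or.inl rfl⟩, _, le_rfl, ⟨h.1, Or.inr rfl⟩, trivial⟩
  | .z n, h =>
    refine ⟨_, Nat.zero_le _, ⟨h.1, Or.inl rfl⟩, _, ?_, ⟨h.1, Or.inr rfl⟩, trivial⟩
    have := pos_lt π h.1
    omega
  | .t n, h => have := h.2; omega

theorem InClass.count_t (hk : 2 ≤ k) (h : InClass π l) {n : ℕ} (hn : n < k) :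
    l.count (.t n) = 1 :=
  (h.1.1 _).mpr (isSimple_t hk hn)

theorem InClass.t_mem (hk : 2 ≤ k) (h : InClass π l) {n : ℕ} (hn : n < k) : .t n ∈ l :=
  List.count_pos_iff.mp (by rw [h.count_t hk hn]; exact one_pos)

/-- This is the point where `β` is finer than `γ`: `t n` separates the first two occurrences of `z
n` in `a0 k π`, and `β` preserves this, whereas the word `z z t` is not alternating and is invisible
to `InClass.ranked`. -/
theorem InClass.not_zzt (hk : 2 ≤ k) (h : InClass π l) {n : ℕ} (hn : n < k) :
    ¬ [.z n, .z n, .t n].Sublist l := by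
  have hp := pos_lt π hn
  have : Sep (.z n) (.t n) (a0 k π) := by
    refine ⟨isSimple_t hk hn, ?_, ?_⟩
    · rw [sublist_a0_iff hk]
      exact ⟨_, Nat.zero_le _, ⟨hn, Or.inl rfl⟩, 3 * k + 2 * n, by omega, ⟨hn, rfl⟩, _, le_rfl,
        ⟨hn, Or.inr rfl⟩, trivial⟩
    · rw [sublist_a0_iff hk]
      rintro ⟨r, -, h1, s, h2, h3, u, h4, h5, -⟩
      simp only [HasRank] at h1 h3 h5
      omega
  exact (((betaRel_iff.mp h).2 _ _).mpr this).2.2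

theorem InClass.not_tx (hk : 2 ≤ k) (h : InClass π l) {n : ℕ} :
    ¬ [.t n, .x].Sublist l := by
  intro hs
  obtain ⟨r, -, h1, s, h2, h3, -⟩ := h.ranked hk hs (by simp)
  simp only [HasRank] at h1 h3
  omega

/-- No `x` follows `t n`, so two occurrences of `z n` before an `x` would both precede `t n`. -/
theorem InClass.not_zzx (hk : 2 ≤ k) (h : InClass π l) {n : ℕ} (hn : n < k) :
    ¬ [.z n, .z n, .x].Sublist l := by
  intro hs
  have h1 := h.not_zzt hk hn
  have h2 := h.not_tx hk (n := n)
  obtain ⟨A, C, rfl⟩ := List.append_of_mem (h.t_mem hk hn)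
  have key : .x ∉ Letter.t n :: C := by
    intro hx
    apply h2
    have : Letter.x ∈ C := by simpa using hx
    exact (List.nil_sublist A).append ((List.singleton_sublist.mpr this).cons_cons _)
  rcases sublist_three hs with h | ⟨-, h⟩ | ⟨-, h⟩ | h
  · apply h1
    have h' : [Letter.z n, .z n].Sublist A := List.Sublist.trans (by simp) h
    exact h'.append ((List.nil_sublist C).cons_cons (.t n))
  · exact key h
  · exact key (h.subset (by simp))
  · exact key (h.subset (by simp))

/-- Every letter strictly between the two `x` of `a0 k π` is multiple. -/
theorem InClass.not_xtx (hk : 2 ≤ k) (h : InClass π l) {t : Letter} (ht : l.count t = 1) :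
    ¬ [.x, t, .x].Sublist l := by
  intro hs
  have htx : t ≠ .x := by
    rintro rfl
    have := hs.count_le Letter.x
    simp at this
    omega
  obtain ⟨r, -, h1, s, h2, h3, u, h4, h5, -⟩ := h.ranked hk hs (by simp [htx, htx.symm])
  refine not_isSimple_of_rank hk h3 ?_ ((h.1.1 t).mp ht)
  simp only [HasRank] at h1 h5
  omega

theorem InClass.congr {p s u v : List Letter} (h : InClass π (p ++ u ++ s))
    (huv : BetaRel (FreeMonoid.ofList u) (FreeMonoid.ofList v)) : InClass π (p ++ v ++ s) := by
  have r : ∀ w : Word, BetaRel w w := fun w => beta.refl w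
  exact BetaRel.trans (BetaRel.mul (BetaRel.mul (r _) huv.symm) (r (FreeMonoid.ofList s))) h

/-- No simple letter ever stands between two `x`, so as long as another `x` is present even the
passage between exponents 1 and 2 respects `β`. -/
theorem InClass.replicate_x (hk : 2 ≤ k) {P Q : List Letter} {m n : ℕ} (hx : .x ∈ P ∨ .x ∈ Q)
    (hm : 1 ≤ m) (hn : 1 ≤ n) (h : InClass π (P ++ List.replicate m .x ++ Q)) :
    InClass π (P ++ List.replicate n .x ++ Q) := by
  have h1 : ∀ {P Q : List Letter}, InClass π (P ++ [.x, .x] ++ Q) → .x ∈ P ∨ .x ∈ Q →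
      InClass π (P ++ [.x] ++ Q) := fun h hx =>
    BetaRel.trans (betaRel_double hx fun t ht => h.not_xtx hk ht) h
  have h2 : ∀ {P Q : List Letter}, InClass π (P ++ [.x] ++ Q) → .x ∈ P ∨ .x ∈ Q →
      InClass π (P ++ [.x, .x] ++ Q) := by
    intro P Q h hx
    refine BetaRel.trans (betaRel_double hx fun t ht hs => ?_).symm h
    have hγ : (P ++ [Letter.x] ++ Q).count t = 1 := by
      by_cases htx : Letter.x = t
      · subst htx
        simp only [List.count_append, List.count_cons_self, List.count_nil] at ht
        omega
      · simpa [List.count_append, htx] using ht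
    have htx : t ≠ .x := by
      rintro rfl
      simp only [List.count_append, List.count_cons_self, List.count_nil] at ht
      omega
    refine h.not_xtx hk hγ ?_
    -- The word `x t x` is alternating, so its occurrence depends only on the skeleton, which
    -- doubling an `x` does not change.
    have e : ∀ l : List Letter, [.x, t, .x].Sublist l ↔
        [.x, t, .x].Sublist (l.destutter (· ≠ ·)) := fun l =>
      ⟨sublist_destutter (by simp [htx, htx.symm]), fun h => h.trans (List.destutter_sublist _ _)⟩
    rw [e] at hs ⊢
    rwa [destutter_append_congr (destutter_append_congr (rfl : P.destutter (· ≠ ·) = _)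
      (?_ : [Letter.x].destutter (· ≠ ·) = [Letter.x, .x].destutter (· ≠ ·)))
      (rfl : Q.destutter (· ≠ ·) = _)]
    simp
  have h3 : InClass π (P ++ [.x, .x] ++ Q) := by
    rcases Nat.lt_or_ge m 2 with hm2 | hm2
    · obtain rfl : m = 1 := by omega
      exact h2 h hx
    · exact h.congr (betaRel_replicate .x hm2 le_rfl)
  rcases Nat.lt_or_ge n 2 with hn2 | hn2
  · obtain rfl : n = 1 := by omega
    exact h1 h3 hx
  · exact h3.congr (betaRel_replicate .x le_rfl hn2)

end
/-! ### The words of the identities -/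

theorem sublist_flatten_ofFn {α : Type*} {n : ℕ} {f : Fin n → List α} {i j : Fin n} (h : i < j)
    {a b : α} (ha : a ∈ f i) (hb : b ∈ f j) : [a, b].Sublist (List.ofFn f).flatten := by
  induction n with
  | zero => exact i.elim0
  | succ n ih =>
    rw [List.ofFn_succ, List.flatten_cons]
    obtain ⟨j, rfl⟩ := Fin.exists_succ_eq.mpr (Fin.ne_zero_of_lt h)
    induction i using Fin.cases with
    | zero =>
      refine List.Sublist.append (l₁ := [a]) (r₁ := [b]) (List.singleton_sublist.mpr ha) ?_
      exact List.singleton_sublist.mpr (List.mem_flatten.mpr ⟨_, List.mem_ofFn.mpr ⟨j, rfl⟩, hb⟩)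
    | succ i =>
      exact (ih (Fin.succ_lt_succ_iff.mp h) ha hb).trans (List.sublist_append_right _ _)

theorem flatten_ofFn_eq {α : Type*} {n : ℕ} {f : Fin n → List α} (j : Fin n)
    (h : ∀ i, i ≠ j → f i = []) : (List.ofFn f).flatten = f j := by
  induction n with
  | zero => exact j.elim0
  | succ n ih =>
    rw [List.ofFn_succ, List.flatten_cons]
    induction j using Fin.cases with
    | zero =>
      have : ∀ i : Fin n, f i.succ = [] := fun i => h _ (Fin.succ_ne_zero i)
      simp [this]
    | succ j =>
      rw [h 0 (Fin.succ_ne_zero j).symm, List.nil_append]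
      exact ih j fun i hi => h _ fun e => hi (Fin.succ_inj.mp e)

section
variable (m : ℕ) (π : Equiv.Perm (Fin (m + 2)))

/-- The three letters that take the place of the first `z`-letter of the block. -/
abbrev firstLetter (i : ℕ) : Letter := .z (m + 2 + i)

/-- The three letters that take the place of the last `z`-letter of the block. -/
abbrev lastLetter (i : ℕ) : Letter := .z (m + 5 + i)

/-- The part of the block of `a0 (m + 2) π` between its first and its last `z`-letter. -/
def core : List Letter :=
  .y 0 :: .y 0 :: (List.ofFn fun i : Fin m =>
    [Letter.z (π i.castSucc.succ), .y (i + 1), .y (i + 1)]).flatten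

/-- The letters `firstLetter m i` in the block, with an `x` inserted after the first if `p`. -/
def firstGroup (p : Bool) : List Letter :=
  firstLetter m 0 :: ((if p then [.x] else []) ++ [firstLetter m 1, firstLetter m 2])

/-- The letters `lastLetter m i` in the block, with an `x` inserted before the last if `q`. -/
def lastGroup (q : Bool) : List Letter :=
  [lastLetter m 0, lastLetter m 1] ++ ((if q then [.x] else []) ++ [lastLetter m 2])

/-- The block of the words in the identities. -/
def block (p q : Bool) : List Letter := firstGroup m p ++ core m π ++ lastGroup m q

/-- The factor of the tail that replaces `t_i z_i`. -/
def tailFactor (i : Fin (m + 2)) : List Letter :=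
  -- The block order 0, 1, 2 is followed by 0, 2, 1 here and by 1, 0, 2 for the last letters. These
  -- two patterns of occurrences are what the order tests recognise.
  if i = π 0 then [.t (m + 2), firstLetter m 0, .t (m + 2 + 2), firstLetter m 2,
    .t (m + 2 + 1), firstLetter m 1]
  else if i = π (Fin.last _) then [.t (m + 5 + 1), lastLetter m 1, .t (m + 5), lastLetter m 0,
    .t (m + 5 + 2), lastLetter m 2]
  else [.t i, .z i]

/-- The tail of the words in the identities. -/
def tail : List Letter := (List.ofFn (tailFactor m π)).flatten

/-- The words in the identities. -/
def word (p q : Bool) : List Letter := .x :: block m π p q ++ .x :: tail m π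

end

section
variable {m : ℕ} {π : Equiv.Perm (Fin (m + 2))} {p q : Bool}

theorem core_eq : Letter.z (π 0) :: core m π =
    (List.ofFn fun i : Fin (m + 1) => [Letter.z (π i.castSucc), .y i, .y i]).flatten := by
  rw [List.ofFn_succ]
  simp [core]

theorem toList_a0 : (a0 (m + 2) π).toList = .x :: .z (π 0) :: core m π ++ .z (π (Fin.last _)) ::
    .x :: (List.ofFn fun i : Fin (m + 2) => [Letter.t i, .z i]).flatten := by
  rw [List.cons_append, core_eq]
  simp only [a0, FreeMonoid.toList_mul, FreeMonoid.toList_of, FreeMonoid.toList_prod,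
    List.map_ofFn, List.append_assoc]
  rw [List.ofFn_succ' (n := m + 1)]
  simp [pow_two, Function.comp_def]

theorem mem_core {u : Letter} (h : u ∈ core m π) :
    (∃ j ≤ m, u = .y j) ∨ ∃ i : Fin m, u = .z (π i.castSucc.succ) := by
  simp only [core, List.mem_cons, List.mem_flatten, List.mem_ofFn] at h
  rcases h with h | h | ⟨_, ⟨i, rfl⟩, h⟩
  · exact Or.inl ⟨0, by omega, h⟩
  · exact Or.inl ⟨0, by omega, h⟩
  · simp only [List.mem_cons, List.not_mem_nil, or_false, or_self] at h
    rcases h with h | h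
    · exact Or.inr ⟨i, h⟩
    · exact Or.inl ⟨i + 1, by omega, h⟩

theorem mem_block {u : Letter} (h : u ∈ block m π p q) :
    u = .x ∨ (∃ i < 3, u = firstLetter m i) ∨ (∃ j ≤ m, u = .y j) ∨
      (∃ i : Fin m, u = .z (π i.castSucc.succ)) ∨ ∃ i < 3, u = lastLetter m i := by
  simp only [block, List.mem_append] at h
  rcases h with (h | h) | h
  · have : u = .x ∨ ∃ i < 3, u = firstLetter m i := by
      have h' : u = .x ∨ u = firstLetter m 0 ∨ u = firstLetter m 1 ∨ u = firstLetter m 2 := by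
        cases p <;> simp [firstGroup] at h <;> tauto
      rcases h' with h | h | h | h
      exacts [.inl h, .inr ⟨0, by omega, h⟩, .inr ⟨1, by omega, h⟩, .inr ⟨2, by omega, h⟩]
    exact this.imp_right .inl
  · exact .inr (.inr ((mem_core h).imp_right .inl))
  · have : u = .x ∨ ∃ i < 3, u = lastLetter m i := by
      have h' : u = .x ∨ u = lastLetter m 0 ∨ u = lastLetter m 1 ∨ u = lastLetter m 2 := by
        cases q <;> simp [lastGroup] at h <;> tauto
      rcases h' with h | h | h | h
      exacts [.inl h, .inr ⟨0, by omega, h⟩, .inr ⟨1, by omega, h⟩, .inr ⟨2, by omega, h⟩]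
    exact this.imp_right fun h => .inr (.inr (.inr h))

theorem y_mem_sublist_core {j : ℕ} (hj : j ≤ m) : [.y j, .y j].Sublist (core m π) := by
  have h : [Letter.y j, .y j].Sublist (Letter.z (π 0) :: core m π) := by
    rw [core_eq]
    refine List.Sublist.trans ?_ (List.sublist_flatten_of_mem
      (List.mem_ofFn.mpr ⟨⟨j, by omega⟩, rfl⟩))
    simp
  simpa [List.sublist_cons_iff] using h

theorem y_y_sublist_core {i j : ℕ} (hij : i < j) (hj : j ≤ m) :
    [.y i, .y j].Sublist (core m π) := by
  have h : [Letter.y i, .y j].Sublist (Letter.z (π 0) :: core m π) := by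
    rw [core_eq]
    exact sublist_flatten_ofFn (i := ⟨i, by omega⟩) (j := ⟨j, by omega⟩) hij (by simp) (by simp)
  simpa [List.sublist_cons_iff] using h

theorem z_sublist_core (i : Fin m) :
    [.y 0, .z (π i.castSucc.succ), .y m].Sublist (core m π) := by
  have h : [Letter.z (π i.castSucc.succ), .y m].Sublist (Letter.z (π 0) :: core m π) := by
    rw [core_eq]
    have := i.2
    rcases Nat.lt_or_ge (i + 1) m with hi | hi
    · exact sublist_flatten_ofFn (i := i.succ) (j := Fin.last m) hi (by simp) (by simp)
    · refine List.Sublist.trans ?_ (List.sublist_flatten_of_mem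
        (List.mem_ofFn.mpr ⟨i.succ, rfl⟩))
      have : m = i + 1 := by omega
      simp [← this]
  have h0 : (Letter.z (π i.castSucc.succ)) ≠ .z (π 0) := by
    simp [Fin.val_inj]
  have h1 : [Letter.z (π i.castSucc.succ), .y m].Sublist (core m π) := by
    rcases List.sublist_cons_iff.mp h with h | ⟨_, h, -⟩
    · exact h
    · exact absurd (List.cons.inj h).1 h0
  rw [core] at h1 ⊢
  refine List.Sublist.cons_cons _ ?_
  simp only [List.sublist_cons_iff (a := Letter.y 0)] at h1
  simpa [List.sublist_cons_iff] using h1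

theorem z_mem_tail (i : Fin m) : .z (π i.castSucc.succ) ∈ tail m π := by
  refine List.mem_flatten.mpr ⟨_, List.mem_ofFn.mpr ⟨π i.castSucc.succ, rfl⟩, ?_⟩
  have h1 : i.castSucc.succ ≠ 0 := by simp [Fin.ext_iff]
  have h2 : i.castSucc.succ ≠ Fin.last (m + 1) := by
    rw [Ne, Fin.ext_iff]
    simp
    omega
  rw [tailFactor, if_neg fun h => h1 (π.injective h), if_neg fun h => h2 (π.injective h)]
  simp

theorem first_sublist_tail :
    [firstLetter m 0, firstLetter m 2, firstLetter m 1].Sublist (tail m π) := by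
  refine List.Sublist.trans ?_ (List.sublist_flatten_of_mem (List.mem_ofFn.mpr ⟨π 0, rfl⟩))
  simp [tailFactor, List.sublist_cons_iff]

theorem last_sublist_tail :
    [lastLetter m 1, lastLetter m 0, lastLetter m 2].Sublist (tail m π) := by
  refine List.Sublist.trans ?_ (List.sublist_flatten_of_mem
    (List.mem_ofFn.mpr ⟨π (Fin.last _), rfl⟩))
  have : Fin.last (m + 1) ≠ 0 := by simp [Fin.ext_iff]
  simp [tailFactor, this, List.sublist_cons_iff]

theorem first_sublist_firstGroup :
    [firstLetter m 0, firstLetter m 1, firstLetter m 2].Sublist (firstGroup m p) := by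
  cases p <;> simp [firstGroup, List.sublist_cons_iff]

theorem last_sublist_lastGroup :
    [lastLetter m 0, lastLetter m 1, lastLetter m 2].Sublist (lastGroup m q) := by
  cases q <;> simp [lastGroup, List.sublist_cons_iff]

theorem x_block_x_sublist_word {l r : List Letter} (hl : l.Sublist (block m π p q))
    (hr : r.Sublist (tail m π)) : (.x :: l ++ .x :: r).Sublist (word m π p q) :=
  (hl.cons_cons _).append (hr.cons_cons _)

theorem block_tail_sublist_word {l r : List Letter} (hl : l.Sublist (block m π p q))
    (hr : r.Sublist (tail m π)) : (l ++ r).Sublist (word m π p q) :=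
  List.Sublist.append (hl.cons _) (hr.cons _)

theorem core_sublist_block {l a b : List Letter} (ha : a.Sublist (firstGroup m p))
    (hl : l.Sublist (core m π)) (hb : b.Sublist (lastGroup m q)) :
    (a ++ l ++ b).Sublist (block m π p q) :=
  (ha.append hl).append hb

/-- Restricted to the first letters the word reads 0, 1, 2, 0, 2, 1, so order questions about them
become decidable statements on numerals. -/
theorem first_sublist_word {l : List ℕ} (h : l.Sublist [0, 1, 2, 0, 2, 1]) :
    (l.map (firstLetter m)).Sublist (word m π p q) := by
  refine (h.map _).trans (block_tail_sublist_word (l := [_, _, _])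
    (core_sublist_block first_sublist_firstGroup (List.nil_sublist _) (List.nil_sublist _))
    first_sublist_tail)

theorem last_sublist_word {l : List ℕ} (h : l.Sublist [0, 1, 2, 1, 0, 2]) :
    (l.map (lastLetter m)).Sublist (word m π p q) := by
  refine (h.map _).trans (block_tail_sublist_word (l := [_, _, _])
    (core_sublist_block (List.nil_sublist _) (List.nil_sublist _) last_sublist_lastGroup)
    last_sublist_tail)

theorem mem_tail_of_mem_block {u : Letter} (h : u ∈ block m π p q) (hx : u ≠ .x)
    (hy : ∀ j, u ≠ .y j) : u ∈ tail m π := by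
  rcases mem_block h with h | ⟨i, hi, rfl⟩ | ⟨j, -, h⟩ | ⟨i, rfl⟩ | ⟨i, hi, rfl⟩
  · exact absurd h hx
  · apply first_sublist_tail.subset
    interval_cases i <;> simp
  · exact absurd h (hy j)
  · exact z_mem_tail i
  · apply last_sublist_tail.subset
    interval_cases i <;> simp

/-- The letters `y j` are squared inside the block, `x` encloses it, and all other block letters
recur in the tail. -/
theorem twice_sublist_word {u : Letter} (h : u ∈ block m π p q ∨ u = .x) :
    [u, u].Sublist (word m π p q) := by
  by_cases hx : u = .x
  · subst hx
    exact x_block_x_sublist_word (l := []) (r := []) (List.nil_sublist _) (List.nil_sublist _)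
  by_cases hy : ∃ j, u = .y j
  · obtain ⟨j, rfl⟩ := hy
    have hj : j ≤ m := by
      rcases mem_block (h.resolve_right hx) with h | ⟨i, hi, h⟩ | ⟨j, hj, h⟩ | ⟨i, h⟩ | ⟨i, hi, h⟩
        <;> grind
    have h1 := core_sublist_block (p := p) (q := q) (List.nil_sublist _)
      (y_mem_sublist_core (π := π) hj) (List.nil_sublist _)
    exact block_tail_sublist_word (r := []) h1 (List.nil_sublist _)
  · exact block_tail_sublist_word (l := [u]) (List.singleton_sublist.mpr (h.resolve_right hx))
      (List.singleton_sublist.mpr (mem_tail_of_mem_block (h.resolve_right hx) hx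
        fun j hj => hy ⟨j, hj⟩))

end
/-! ### Images of letters under substitutions into the `β`-class of `a0 k π` -/

section
variable {k : ℕ} {π : Equiv.Perm (Fin k)} {n r : ℕ}

theorem hasRank_x : HasRank π .x r ↔ r = 0 ∨ r = 3 * k - 1 := Iff.rfl

theorem hasRank_y : HasRank π (.y n) r ↔ n + 1 < k ∧ (r = 3 * n + 2 ∨ r = 3 * n + 3) := Iff.rfl

theorem hasRank_z : HasRank π (.z n) r ↔
    n < k ∧ pos π n < k ∧ (r = 3 * pos π n + 1 ∨ r = 3 * k + 2 * n + 1) :=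
  and_congr_right fun h => (and_iff_right (pos_lt π h)).symm

theorem hasRank_t : HasRank π (.t n) r ↔ n < k ∧ r = 3 * k + 2 * n := Iff.rfl

end

theorem pair_sublist_or {α : Type*} {c d : α} {U : List α} (hc : c ∈ U) (hd : d ∈ U) (hn : c ≠ d) :
    [c, d].Sublist U ∨ [d, c].Sublist U := by
  obtain ⟨P, Q, rfl⟩ := List.append_of_mem hc
  rcases List.mem_append.mp hd with h | h
  · exact .inr ((List.singleton_sublist.mpr h).append ((List.nil_sublist Q).cons_cons c))
  · refine .inl ((List.nil_sublist P).append
      ((List.singleton_sublist.mpr ((List.mem_cons.mp h).resolve_left hn.symm)).cons_cons c))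

theorem exists_append_of_twice {α : Type*} {u : α} {X : List α} (h : [u, u].Sublist X) :
    ∃ P Q R, X = P ++ [u] ++ Q ++ [u] ++ R := by
  obtain ⟨P, Q, rfl, h1, h2⟩ := List.cons_sublist_iff.mp h
  obtain ⟨P1, P2, rfl⟩ := List.append_of_mem h1
  obtain ⟨Q1, Q2, rfl⟩ := List.append_of_mem (List.singleton_sublist.mp h2)
  exact ⟨P1, P2 ++ Q1, Q2, by simp⟩

section
variable {k : ℕ} {π : Equiv.Perm (Fin k)}

/-- A factor that occurs twice is a power of one letter: two distinct letters in it would give the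
alternating word `c d c d`. The places exclude this at once unless `d` is a `z`-letter. -/
theorem InClass.eq_of_mem_twice (hk : 2 ≤ k) {A U B D : List Letter}
    (h : InClass π (A ++ U ++ B ++ U ++ D)) {c d : Letter} (hc : c ∈ U) (hd : d ∈ U) : c = d := by
  have key : ∀ c d, c ≠ d → ¬ [c, d].Sublist U := by
    intro c d hcd hs
    have hn (l : List Letter) := List.nil_sublist l
    obtain ⟨r1, -, h1, r2, h12, h2, r3, h23, h3, r4, h34, h4, -⟩ := h.ranked hk
      (ls := [c, d, c, d]) (((((hn A).append hs).append (hn B)).append hs).append (hn D))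
      (by simp [hcd, hcd.symm])
    have hd : [d].Sublist U := .trans (by simp) hs
    have hc : [c].Sublist U := .trans (by simp) hs
    match d with
    | .x => cases c <;> simp only [hasRank_x, hasRank_y, hasRank_z, hasRank_t] at h1 h2 h3 h4 <;> omega
    | .y _ => simp only [hasRank_y] at h2 h4; omega
    | .t _ => simp only [hasRank_t] at h2 h4; omega
    -- The position of `t j` decides. Before both copies of `U`, it forces `c` to occur twice in the
    -- tail. Between them, `c` would have to fit between the adjacent places of `t j` and the second
    -- `z j`. After them, `z j` occurs twice before `t j`.
    | .z j =>
      have hj : j < k := h2.1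
      have ht := h.t_mem hk hj
      have ht1 := h.count_t hk hj
      have htc : Letter.t j ≠ c := by
        rintro rfl
        simp only [hasRank_t] at h1 h3
        omega
      simp only [List.mem_append] at ht
      rcases ht with (((ht | ht) | ht) | ht) | ht
      · obtain ⟨s1, -, k1, s2, k12, k2, s3, k23, k3, s4, k34, k4, -⟩ := h.ranked hk
          (ls := [.t j, c, .z j, c])
          (((((List.singleton_sublist.mpr ht).append hs).append (hn B)).append hc).append (hn D))
          (by simp [hcd, hcd.symm, htc])
        cases c <;> simp only [hasRank_x, hasRank_y, hasRank_z, hasRank_t] at k1 k2 k3 k4 <;> omega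
      · have := List.count_pos_iff.mpr ht
        simp only [List.count_append] at ht1
        omega
      · obtain ⟨s1, -, k1, s2, k12, k2, s3, k23, k3, s4, k34, k4, s5, k45, k5, -⟩ := h.ranked hk
          (ls := [c, .z j, .t j, c, .z j])
          (((((hn A).append hs).append (List.singleton_sublist.mpr ht)).append hs).append (hn D))
          (by simp [hcd, htc])
        cases c <;> simp only [hasRank_x, hasRank_y, hasRank_z, hasRank_t] at k1 k2 k3 k4 k5 <;> omega
      · have := List.count_pos_iff.mpr ht
        simp only [List.count_append] at ht1
        omega
      · exact h.not_zzt hk hj (((((hn A).append hd).append (hn B)).append hd).append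
          (List.singleton_sublist.mpr ht))
  by_contra hcd
  rcases pair_sublist_or hc hd hcd with hs | hs
  · exact key _ _ hcd hs
  · exact key _ _ (Ne.symm hcd) hs

variable {g : Letter → List Letter} {A D X : List Letter}

theorem InClass.eq_of_mem (hk : 2 ≤ k) (h : InClass π (A ++ X.flatMap g ++ D)) {u : Letter}
    (hu : [u, u].Sublist X) {c d : Letter} (hc : c ∈ g u) (hd : d ∈ g u) : c = d := by
  obtain ⟨P, Q, R, rfl⟩ := exists_append_of_twice hu
  refine InClass.eq_of_mem_twice (π := π) (A := A ++ P.flatMap g) (B := Q.flatMap g) (U := g u)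
    (D := R.flatMap g ++ D) hk ?_ hc hd
  simpa using h

theorem sublist_image {ds us : List Letter} (hs : us.Sublist X)
    (hf : List.Forall₂ (fun d u => d ∈ g u) ds us) : ds.Sublist (A ++ X.flatMap g ++ D) :=
  (sublist_flatMap_of_forall₂ hf hs).trans
    ((List.sublist_append_right _ _).trans (List.sublist_append_left _ _))

theorem InClass.t_notMem (hk : 2 ≤ k) (h : InClass π (A ++ X.flatMap g ++ D)) {u : Letter}
    (hu : [u, u].Sublist X) {n : ℕ} (hn : n < k) : .t n ∉ g u := by
  intro ht
  have := (sublist_image (A := A) (D := D) hu (.cons ht (.cons ht .nil))).count_le (.t n)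
  rw [h.count_t hk hn] at this
  simp at this

/-- If the image of a block of repeated letters has a letter different from a letter `c` of the
image of the letter enclosing the block, then `c` is `x`. -/
theorem InClass.eq_x_of_enclosed (hk : 2 ≤ k) {B T : List Letter} {u : Letter}
    (h : InClass π (A ++ (u :: B ++ u :: T).flatMap g ++ D))
    (hB : ∀ e ∈ B, [e, e].Sublist (u :: B ++ u :: T)) {c d e : Letter} (hc : c ∈ g u) (he : e ∈ B)
    (hd : d ∈ g e) (hcd : c ≠ d) : c = .x := by
  have hs : [u, e, u].Sublist (u :: B ++ u :: T) :=
    ((List.singleton_sublist.mpr he).cons_cons u).append ((List.nil_sublist T).cons_cons u)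
  have hu : [u, u].Sublist (u :: B ++ u :: T) := .trans (by simp) hs
  obtain ⟨r1, -, h1, r2, h12, h2, r3, h23, h3, -⟩ := h.ranked hk
    (sublist_image hs (.cons hc (.cons hd (.cons hc .nil)))) (by simp [hcd, hcd.symm])
  match c with
  | .x => rfl
  | .y _ => cases d <;> simp only [hasRank_x, hasRank_y, hasRank_z, hasRank_t] at h1 h2 h3 <;> omega
  | .t _ => simp only [hasRank_t] at h1 h3; omega
  -- The simple letter `t n` cannot lie in the image of a repeated letter, so it stands before or
  -- after the enclosed stretch. In the first case `z n` would have to occur twice in the tail, in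
  -- the second twice before `t n`.
  | .z n =>
    have hn : n < k := h1.1
    have ht := h.t_mem hk hn
    have hcs := List.singleton_sublist.mpr hc
    have hds := List.singleton_sublist.mpr (List.mem_flatMap.mpr ⟨e, he, hd⟩)
    have hnl (l : List Letter) := List.nil_sublist l
    have e1 : A ++ (u :: B ++ u :: T).flatMap g ++ D =
      A ++ (g u ++ (B.flatMap g ++ (g u ++ (T.flatMap g ++ D)))) := by simp
    have ht' := h.t_notMem hk hu hn
    simp only [e1, List.mem_append, ht', false_or] at ht
    rw [e1] at h
    rcases ht with ht | ht | ht
    · have htd : Letter.t n ≠ .z n := by simp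
      obtain ⟨s1, -, k1, s2, k12, k2, s3, k23, k3, s4, k34, k4, -⟩ := h.ranked hk
        (ls := [.t n, .z n, d, .z n]) ((List.singleton_sublist.mpr ht).append
          (hcs.append (hds.append (hcs.append (hnl _))))) (by simp [hcd, hcd.symm])
      cases d <;> simp only [hasRank_x, hasRank_y, hasRank_z, hasRank_t] at k1 k2 k3 k4 <;> omega
    · obtain ⟨e', he', ht⟩ := List.mem_flatMap.mp ht
      rw [← e1] at h
      exact absurd ht (h.t_notMem hk (hB e' he') hn)
    · exact absurd ((hnl _).append (hcs.append ((hnl _).append (hcs.append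
        (List.singleton_sublist.mpr (List.mem_append.mpr ht)))))) (h.not_zzt hk hn)

/-- A letter that has to occur between two `x` occurs in the image of the block. -/
theorem InClass.mem_block_image (hk : 2 ≤ k) {B T : List Letter} {u : Letter}
    (h : InClass π (A ++ (u :: B ++ u :: T).flatMap g ++ D))
    (hx : .x ∈ g u) {d e : Letter} (he : e ∈ B) (hd : d ∈ g e) (hdx : d ≠ .x)
    (hu : ∀ c ∈ g u, c = .x) {b : Letter} (hb : Ranked π 0 [.x, b, .x]) (hbx : b ≠ .x) :
    ∃ v ∈ B, b ∈ g v := by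
  suffices b ∈ B.flatMap g from List.mem_flatMap.mp this
  by_contra hbB
  have hs := h.sublist hk hb (by simp [hbx, hbx.symm])
  have hds : [d].Sublist (B.flatMap g) :=
    List.singleton_sublist.mpr (List.mem_flatMap.mpr ⟨e, he, hd⟩)
  have hxs := List.singleton_sublist.mpr hx
  have hnl (l : List Letter) := List.nil_sublist l
  have hbu : b ∉ g u := fun h => hbx (hu b h)
  have e1 : A ++ (u :: B ++ u :: T).flatMap g ++ D =
      A ++ ((g u ++ B.flatMap g ++ g u) ++ (T.flatMap g ++ D)) := by simp
  rw [e1] at h hs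
  have hbM : b ∉ g u ++ B.flatMap g ++ g u := by simp only [List.mem_append]; tauto
  have hM : [.x, d, .x].Sublist (g u ++ B.flatMap g ++ g u) := (hxs.append hds).append hxs
  -- Either word has three occurrences of `x` kept apart by other letters, but `a0 k π` offers only
  -- two places for `x`.
  have hc1 : ∀ l : List Letter, l = [.x, b, .x, d, .x] ∨ l = [.x, d, .x, b, .x] →
      ¬ l.Sublist (A ++ ((g u ++ B.flatMap g ++ g u) ++ (T.flatMap g ++ D))) := by
    rintro l (rfl | rfl) hl
    all_goals
      obtain ⟨s1, -, k1, s2, k12, k2, s3, k23, k3, s4, k34, k4, s5, k45, k5, -⟩ := h.ranked hk hl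
        (by simp [hbx, hbx.symm, hdx, hdx.symm])
      simp only [hasRank_x] at k1 k3 k5
      omega
  have c1 : ¬ [.x, b].Sublist A := fun h => hc1 _ (.inl rfl) (h.append (hM.append (hnl _)))
  have c2 : ¬ [b, .x].Sublist ((g u ++ B.flatMap g ++ g u) ++ (T.flatMap g ++ D)) := by
    intro h
    rcases sublist_two h with h | h | h
    · exact hbM (h.subset (by simp))
    · exact hbM h.1
    · exact hc1 _ (.inr rfl) ((hnl A).append (hM.append h))
  rcases sublist_three hs with h | h | h | h
  · exact c1 (.trans (by simp) h)
  · exact c1 h.1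
  · exact c2 h.2
  · exact c2 (.trans (by simp) h)

end
/-! ### Substitutions that map a word of the identities into the `β`-class of `a0 k π` -/

section
variable {m : ℕ} {π : Equiv.Perm (Fin (m + 2))} {p q : Bool} {g : Letter → List Letter}
  {A D : List Letter}

/-- The substitution `g` maps the block together with the two `x` around it to a power of a
letter. -/
def Flat (π : Equiv.Perm (Fin (m + 2))) (g : Letter → List Letter) : Prop :=
  -- The block with both insertions contains `x` and all letters of the other blocks, so this
  -- condition does not depend on which insertions are present.
  g .x = [] ∨ ∃ c ∈ g .x, ∀ u ∈ block m π true true, ∀ d ∈ g u, d = c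

/-- The substitution `g` maps the block of `word m π p q` onto the block of `a0 (m + 2) π`. -/
structure Spanning (π : Equiv.Perm (Fin (m + 2))) (p q : Bool) (g : Letter → List Letter) :
    Prop where
  x_mem : .x ∈ g .x
  eq_x : ∀ c ∈ g .x, c = .x
  y_mem : .y 0 ∈ g (.y 0)
  exists_z : ∀ i, ∃ u ∈ block m π p q, .z (π i) ∈ g u
  exists_first : ∃ i < 3, .z (π 0) ∈ g (firstLetter m i) ∧ (p = true → i ≠ 0) ∧
    (i ≠ 0 → ∀ d ∈ g (firstLetter m 0), d = .x)
  exists_last : ∃ i < 3, .z (π (Fin.last _)) ∈ g (lastLetter m i) ∧ (q = true → i ≠ 2) ∧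
    (i ≠ 2 → ∀ d ∈ g (lastLetter m 2), d = .x)

theorem mem_block_true {u : Letter} (h : u ∈ block m π p q ∨ u = .x) :
    u ∈ block m π true true := by
  cases p <;> cases q <;> simp [block, firstGroup, lastGroup] at h ⊢ <;> tauto

theorem mem_block_of_mem_true {u : Letter} (h : u ∈ block m π true true) :
    u ∈ block m π p q ∨ u = .x := by
  cases p <;> cases q <;> simp [block, firstGroup, lastGroup] at h ⊢ <;> tauto

theorem block_sublist_word {l : List Letter} (hl : l.Sublist (block m π p q)) :
    l.Sublist (word m π p q) := by
  simpa using block_tail_sublist_word hl (List.nil_sublist (tail m π))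

theorem y_sublist_core {j : ℕ} (hj : j ≤ m) : [.y j].Sublist (core m π) :=
  List.singleton_sublist.mpr ((y_mem_sublist_core hj).subset (by simp))

theorem x_sublist_word {l : List Letter} (hl : l.Sublist (block m π p q)) :
    (Letter.x :: l ++ [Letter.x]).Sublist (word m π p q) :=
  x_block_x_sublist_word hl (List.nil_sublist _)

/-- If `x` is erased, the insertions leave no trace. Otherwise the stretch from `x` to `x` becomes a
power of `c` with exponent at least 2, because each of the two `x` contributes, and the insertions
only change this exponent. -/
theorem InClass.flat_congr (h : InClass π (A ++ (word m π p q).flatMap g ++ D)) (hf : Flat π g)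
    (p' q' : Bool) : InClass π (A ++ (word m π p' q').flatMap g ++ D) := by
  rcases hf with hx | ⟨c, hc, hu⟩
  · have (p q : Bool) : (word m π p q).flatMap g = (word m π false false).flatMap g := by
      cases p <;> cases q <;> simp [word, block, firstGroup, lastGroup, hx]
    rwa [this, ← this p q]
  · have key (p q : Bool) : ∃ N ≥ 2, (word m π p q).flatMap g =
        List.replicate N c ++ (tail m π).flatMap g := by
      have hr : (Letter.x :: block m π p q ++ [Letter.x]).flatMap g =
          List.replicate ((Letter.x :: block m π p q ++ [Letter.x]).flatMap g).length c := by
        rw [List.eq_replicate_iff]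
        refine ⟨rfl, fun d hd => ?_⟩
        obtain ⟨u, hu', hd⟩ := List.mem_flatMap.mp hd
        refine hu u (mem_block_true (p := p) (q := q) ?_) d hd
        simp only [List.cons_append, List.mem_cons, List.mem_append, List.not_mem_nil,
          or_false] at hu'
        tauto
      refine ⟨((Letter.x :: block m π p q ++ [Letter.x]).flatMap g).length, ?_, ?_⟩
      · have := List.length_pos_of_mem hc
        simp
        omega
      · rw [← hr]
        simp [word]
    obtain ⟨N, hN, e⟩ := key p q
    obtain ⟨N', hN', e'⟩ := key p' q'
    rw [e, ← List.append_assoc, List.append_assoc _ _ D] at h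
    rw [e', ← List.append_assoc, List.append_assoc _ _ D]
    exact h.congr (betaRel_replicate c hN hN')

theorem flatMap_eq_replicate {g : Letter → List Letter} {l : List Letter}
    (h : ∀ u ∈ l, ∀ d ∈ g u, d = .x) : ∃ N, l.flatMap g = List.replicate N .x := by
  refine ⟨_, List.eq_replicate_iff.mpr ⟨rfl, fun d hd => ?_⟩⟩
  obtain ⟨u, hu, hd⟩ := List.mem_flatMap.mp hd
  exact h u hu d hd

/-- The inserted `x` merges with the opening one: between them stands only `firstLetter m 0`, whose
image consists of `x`. The closing `x` of the block is the further occurrence that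
`InClass.replicate_x` needs. -/
theorem InClass.congr_first (h : InClass π (A ++ (word m π p q).flatMap g ++ D))
    (hx : .x ∈ g .x) (hgx : ∀ c ∈ g .x, c = .x) (hf : ∀ d ∈ g (firstLetter m 0), d = .x)
    (p' : Bool) : InClass π (A ++ (word m π p' q).flatMap g ++ D) := by
  let M (p : Bool) : List Letter := .x :: firstLetter m 0 :: if p then [.x] else []
  let Q : List Letter := [firstLetter m 1, firstLetter m 2] ++ core m π ++ lastGroup m q ++
    .x :: tail m π
  have e (p : Bool) : A ++ (word m π p q).flatMap g ++ D =
      A ++ (M p).flatMap g ++ (Q.flatMap g ++ D) := by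
    cases p <;> simp [M, Q, word, block, firstGroup]
  have hM (p : Bool) : ∃ N ≥ 1, (M p).flatMap g = List.replicate N .x := by
    obtain ⟨N, hN⟩ := flatMap_eq_replicate (g := g) (l := M p) (by
      cases p <;> simp only [M, List.mem_cons] <;> simp <;> grind)
    refine ⟨N, ?_, hN⟩
    have : Letter.x ∈ (M p).flatMap g := List.mem_flatMap.mpr ⟨.x, by simp [M], hx⟩
    rw [hN, List.mem_replicate] at this
    omega
  obtain ⟨N, hN, e1⟩ := hM p
  obtain ⟨N', hN', e1'⟩ := hM p'
  rw [e, e1] at h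
  rw [e, e1']
  refine h.replicate_x (by omega) (.inr ?_) hN hN'
  exact List.mem_append_left _ (List.mem_flatMap.mpr ⟨.x, by simp [Q], hx⟩)

theorem InClass.congr_last (h : InClass π (A ++ (word m π p q).flatMap g ++ D))
    (hx : .x ∈ g .x) (hgx : ∀ c ∈ g .x, c = .x) (hf : ∀ d ∈ g (lastLetter m 2), d = .x)
    (q' : Bool) : InClass π (A ++ (word m π p q').flatMap g ++ D) := by
  let M (q : Bool) : List Letter := (if q then [.x] else []) ++ [lastLetter m 2, .x]
  let P : List Letter := .x :: firstGroup m p ++ core m π ++ [lastLetter m 0, lastLetter m 1]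
  have e (q : Bool) : A ++ (word m π p q).flatMap g ++ D =
      (A ++ P.flatMap g) ++ (M q).flatMap g ++ ((tail m π).flatMap g ++ D) := by
    cases q <;> simp [M, P, word, block, lastGroup]
  have hM (q : Bool) : ∃ N ≥ 1, (M q).flatMap g = List.replicate N .x := by
    obtain ⟨N, hN⟩ := flatMap_eq_replicate (g := g) (l := M q) (by
      cases q <;> simp only [M] <;> simp <;> grind)
    refine ⟨N, ?_, hN⟩
    have : Letter.x ∈ (M q).flatMap g := List.mem_flatMap.mpr ⟨.x, by simp [M], hx⟩
    rw [hN, List.mem_replicate] at this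
    omega
  obtain ⟨N, hN, e1⟩ := hM q
  obtain ⟨N', hN', e1'⟩ := hM q'
  rw [e, e1] at h
  rw [e, e1']
  refine h.replicate_x (by omega) (.inl ?_) hN hN'
  exact List.mem_append_right _ (List.mem_flatMap.mpr ⟨.x, by simp [P], hx⟩)

/-! ### Sources of the block letters under a spanning substitution -/

theorem le_of_y_mem_block {j : ℕ} (h : .y j ∈ block m π p q) : j ≤ m := by
  rcases mem_block h with h | ⟨i, hi, h⟩ | ⟨j, hj, h⟩ | ⟨i, h⟩ | ⟨i, hi, h⟩ <;> grind

/-- Every `y i` must come from some block letter. That letter is again a `y`, since any other one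
recurs in the tail and would put `y i` behind the second `x`. Order and uniqueness of images make
the resulting map of indices strictly increasing. -/
theorem InClass.y_mem_image (h : InClass π (A ++ (word m π p q).flatMap g ++ D))
    (hx : .x ∈ g .x) (hgx : ∀ c ∈ g .x, c = .x) {d e : Letter} (he : e ∈ block m π p q)
    (hd : d ∈ g e) (hdx : d ≠ .x) {n : ℕ} (hn : n ≤ m) : .y n ∈ g (.y n) := by
  have hk : 2 ≤ m + 2 := by omega
  have h1 : ∀ i : Fin (m + 1), ∃ j : Fin (m + 1), Letter.y i ∈ g (.y j) := by
    intro i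
    obtain ⟨v, hv, hi⟩ := h.mem_block_image hk hx he hd hdx hgx (b := .y i)
      ⟨0, le_rfl, .inl rfl, _, by omega, ⟨by omega, .inl rfl⟩, _, by omega, .inr rfl, trivial⟩
      (by simp)
    have hvx : v ≠ .x := by
      rintro rfl
      exact absurd (hgx _ hi) (by simp)
    by_cases hy : ∃ j, v = .y j
    · obtain ⟨j, rfl⟩ := hy
      exact ⟨⟨j, Nat.lt_succ_of_le (le_of_y_mem_block hv)⟩, hi⟩
    · have hs := x_block_x_sublist_word (List.singleton_sublist.mpr he)
        (List.singleton_sublist.mpr (mem_tail_of_mem_block hv hvx fun j hj => hy ⟨j, hj⟩))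
      obtain ⟨r1, -, k1, r2, k12, k2, r3, k23, k3, r4, k34, k4, -⟩ := h.ranked hk
        (sublist_image hs (.cons hx (.cons hd (.cons hx (.cons hi .nil)))))
        (by simp [hdx, hdx.symm])
      simp only [hasRank_x, hasRank_y] at k1 k3 k4
      omega
  choose f hf using h1
  have hmono : StrictMono f := by
    intro i j hij
    by_contra hji
    rcases (not_lt.mp hji).eq_or_lt with hji | hji
    · have h1 := hf j
      rw [hji] at h1
      have := h.eq_of_mem hk (twice_sublist_word (.inl ?_)) (hf i) h1
      · simp only [Letter.y.injEq, Fin.val_inj] at this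
        omega
      · exact List.singleton_sublist.mp (core_sublist_block (List.nil_sublist _)
          (y_sublist_core (j := f i) (by omega)) (List.nil_sublist _))
    · have hs := block_sublist_word (p := p) (q := q) (core_sublist_block (List.nil_sublist _)
        (y_y_sublist_core (π := π) (i := f j) (j := f i) hji (by omega)) (List.nil_sublist _))
      have hij' : (i : ℕ) < j := hij
      obtain ⟨r1, -, k1, r2, k12, k2, -⟩ := h.ranked hk
        (sublist_image hs (.cons (hf j) (.cons (hf i) .nil))) (by simp; omega)
      simp only [hasRank_y] at k1 k2
      omega
  -- A strictly increasing self-map of a finite chain is the identity.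
  have hid : f ⟨n, by omega⟩ = ⟨n, by omega⟩ := le_antisymm (hmono.apply_le) (hmono.le_apply)
  have := hf ⟨n, by omega⟩
  rwa [hid] at this

/-- The square of `y j` lies before the closing `x`, so `z n` would occur twice before an `x`. -/
theorem InClass.not_z_mem_y (h : InClass π (A ++ (word m π p q).flatMap g ++ D))
    (hx : .x ∈ g .x) {j n : ℕ} (hj : j ≤ m) (hn : n < m + 2) : .z n ∉ g (.y j) := by
  intro hz
  have hs := x_sublist_word (p := p) (q := q) (core_sublist_block (List.nil_sublist _)
    (y_mem_sublist_core (π := π) hj) (List.nil_sublist _))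
  exact h.not_zzx (by omega) hn (.trans (List.sublist_cons_self .x _)
    (sublist_image hs (.cons hx (.cons hz (.cons hz (.cons hx .nil))))))

/-- Between the two `x`, the letter `z (π 0)` stands before `y 0`, and `y 0` comes from `y 0`. So
the source of `z (π 0)` can only be one of the letters of the block before `y 0`. -/
theorem InClass.exists_first (h : InClass π (A ++ (word m π p q).flatMap g ++ D))
    (hx : .x ∈ g .x) (hgx : ∀ c ∈ g .x, c = .x) (hy : .y 0 ∈ g (.y 0))
    (hz : ∃ u ∈ block m π p q, .z (π 0) ∈ g u) : ∃ i < 3, .z (π 0) ∈ g (firstLetter m i) ∧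
      (p = true → i ≠ 0) ∧ (i ≠ 0 → ∀ d ∈ g (firstLetter m 0), d = .x) := by
  have hk : 2 ≤ m + 2 := by omega
  have hp : pos π (π 0) = 0 := pos_apply π 0
  obtain ⟨u, hu, hz⟩ := hz
  have h1 : ∃ i < 3, u = firstLetter m i := by
    by_contra hfirst
    have hs : u ≠ .y 0 → [.y 0, u].Sublist (block m π p q) → False := by
      intro hu0 hs
      obtain ⟨r1, -, k1, r2, k12, k2, r3, k23, k3, -⟩ := h.ranked hk (ls := [.y 0, .z (π 0), .x])
        (.trans (List.sublist_cons_self .x _) (sublist_image (x_sublist_word hs)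
          (.cons hx (.cons hy (.cons hz (.cons hx .nil)))))) (by simp)
      simp only [hasRank_x, hasRank_y, hasRank_z, hp] at k1 k2 k3
      omega
    rcases mem_block hu with rfl | hu | ⟨j, hj, rfl⟩ | ⟨i, rfl⟩ | ⟨i, hi, rfl⟩
    · exact absurd (hgx _ hz) (by simp)
    · exact hfirst hu
    · exact h.not_z_mem_y hx hj (π 0).2 hz
    · exact hs (by simp) (core_sublist_block (List.nil_sublist _) (l := [_, _])
        (.trans (by simp) (z_sublist_core i)) (List.nil_sublist _))
    · refine hs (by simp) (core_sublist_block (List.nil_sublist _)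
        (l := [.y 0]) (y_sublist_core (Nat.zero_le _))
        (.trans (List.singleton_sublist.mpr ?_) last_sublist_lastGroup))
      interval_cases i <;> simp
  obtain ⟨i, hi, rfl⟩ := h1
  refine ⟨i, hi, hz, ?_, ?_⟩
  -- The inserted `x` would already be the closing one, with `y 0` after it.
  · rintro rfl rfl
    have hs : [.x, firstLetter m 0, .x, .y 0].Sublist (word m π true q) := by
      refine List.Sublist.cons_cons _ (List.Sublist.trans (l₂ := block m π true q) ?_
        (List.sublist_append_left _ _))
      exact core_sublist_block (a := [firstLetter m 0, .x]) (by simp [firstGroup])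
        (y_sublist_core (Nat.zero_le _)) (List.nil_sublist _)
    obtain ⟨r1, -, k1, r2, k12, k2, r3, k23, k3, r4, k34, k4, -⟩ := h.ranked hk
      (sublist_image hs (.cons hx (.cons hz (.cons hx (.cons hy .nil))))) (by simp)
    simp only [hasRank_x, hasRank_y] at k1 k3 k4
    omega
  -- There is no place between the opening `x` and `z (π 0)`, and a second `z (π 0)` before the
  -- closing `x` is impossible, so whatever precedes the source maps to powers of `x`.
  · intro hi0 d hd
    by_contra hdx
    have hs : [firstLetter m 0, firstLetter m i].Sublist (block m π p q) := by
      refine core_sublist_block (a := [_, _]) (.trans ?_ first_sublist_firstGroup) (List.nil_sublist _)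
        (List.nil_sublist _)
      interval_cases i <;> simp at hi0 ⊢
    have hs := sublist_image (A := A) (D := D) (x_sublist_word hs)
      (.cons hx (.cons hd (.cons hz (.cons hx .nil))))
    by_cases hdz : d = .z (π 0)
    · subst hdz
      exact h.not_zzx hk (π 0).2 (.trans (List.sublist_cons_self .x _) hs)
    · obtain ⟨r1, -, k1, r2, k12, k2, r3, k23, k3, r4, k34, k4, -⟩ := h.ranked hk hs
        (by simp [hdz, Ne.symm hdx])
      simp only [hasRank_x, hasRank_z, hp] at k1 k3 k4
      omega

/-- Mirror image of `InClass.exists_first`: the last `z`-letter stands after `y m` and immediately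
before the closing `x`. -/
theorem InClass.exists_last (h : InClass π (A ++ (word m π p q).flatMap g ++ D))
    (hx : .x ∈ g .x) (hgx : ∀ c ∈ g .x, c = .x) (hy0 : .y 0 ∈ g (.y 0)) (hy : .y m ∈ g (.y m))
    (hz : ∃ u ∈ block m π p q, .z (π (Fin.last _)) ∈ g u) :
    ∃ i < 3, .z (π (Fin.last _)) ∈ g (lastLetter m i) ∧ (q = true → i ≠ 2) ∧
      (i ≠ 2 → ∀ d ∈ g (lastLetter m 2), d = .x) := by
  have hk : 2 ≤ m + 2 := by omega
  have hp : pos π (π (Fin.last _)) = m + 1 := pos_apply π (Fin.last _)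
  obtain ⟨u, hu, hz⟩ := hz
  have h1 : ∃ i < 3, u = lastLetter m i := by
    by_contra hlast
    have hs : [u, .y m].Sublist (block m π p q) → False := by
      intro hs
      obtain ⟨r1, -, k1, r2, k12, k2, -⟩ := h.ranked hk
        (sublist_image (block_sublist_word hs) (.cons hz (.cons hy .nil))) (by simp)
      simp only [hasRank_y, hasRank_z, hp] at k1 k2
      omega
    rcases mem_block hu with rfl | ⟨i, hi, rfl⟩ | ⟨j, hj, rfl⟩ | ⟨i, rfl⟩ | hu
    · exact absurd (hgx _ hz) (by simp)
    · refine hs (core_sublist_block (a := [_])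
        (.trans (List.singleton_sublist.mpr ?_) first_sublist_firstGroup) (l := [.y m])
        (y_sublist_core le_rfl) (List.nil_sublist _))
      interval_cases i <;> simp
    · exact h.not_z_mem_y hx hj (π (Fin.last _)).2 hz
    · exact hs (core_sublist_block (List.nil_sublist _) (l := [_, _])
        (.trans (by simp) (z_sublist_core i)) (List.nil_sublist _))
    · exact hlast hu
  obtain ⟨i, hi, rfl⟩ := h1
  refine ⟨i, hi, hz, ?_, ?_⟩
  · rintro rfl rfl
    have hs : [.y 0, .x, lastLetter m 2, .x].Sublist (word m π p true) := by
      have : [.y 0, .x, lastLetter m 2].Sublist (block m π p true) :=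
        core_sublist_block (List.nil_sublist _) (l := [.y 0])
          (y_sublist_core (Nat.zero_le _))
          (by simp [lastGroup])
      exact .trans (List.sublist_cons_self Letter.x _) (x_sublist_word this)
    obtain ⟨r1, -, k1, r2, k12, k2, r3, k23, k3, r4, k34, k4, -⟩ := h.ranked hk
      (sublist_image hs (.cons hy0 (.cons hx (.cons hz (.cons hx .nil))))) (by simp)
    simp only [hasRank_x, hasRank_y] at k1 k2 k4
    omega
  · intro hi0 d hd
    by_contra hdx
    have hs : [lastLetter m i, lastLetter m 2].Sublist (block m π p q) := by
      refine core_sublist_block (List.nil_sublist _) (List.nil_sublist _)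
        (.trans ?_ last_sublist_lastGroup)
      interval_cases i <;> simp [List.sublist_cons_iff] at hi0 ⊢
    have hs := sublist_image (A := A) (D := D) (x_sublist_word hs)
      (.cons hx (.cons hz (.cons hd (.cons hx .nil))))
    by_cases hdz : d = .z (π (Fin.last _))
    · subst hdz
      exact h.not_zzx hk (π (Fin.last _)).2 (.trans (List.sublist_cons_self .x _) hs)
    · obtain ⟨r1, -, k1, r2, k12, k2, r3, k23, k3, r4, k34, k4, -⟩ := h.ranked hk hs
        (by simp [Ne.symm hdz, hdx])
      simp only [hasRank_x, hasRank_z, hp] at k1 k2 k4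
      omega

/-- If the stretch from `x` to `x` is not flat, it contains a letter `d` different from a letter `c`
of the image of `x`. Being enclosed by two copies of `c`, it forces `c = x`. Then `x d x` is
present, and everything between the two `x` of `a0 (m + 2) π` must come from the block. -/
theorem InClass.flat_or_spanning (h : InClass π (A ++ (word m π p q).flatMap g ++ D)) :
    Flat π g ∨ Spanning π p q g := by
  have hk : 2 ≤ m + 2 := by omega
  by_cases hf : Flat π g
  · exact .inl hf
  right
  simp only [Flat, not_or] at hf
  obtain ⟨hg, hf⟩ := hf
  obtain ⟨c, hc⟩ := List.exists_mem_of_ne_nil _ hg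
  have h1 : ∃ e ∈ block m π p q, ∃ d ∈ g e, d ≠ c := by
    by_contra! hne
    refine hf ⟨c, hc, fun u hu d hd => ?_⟩
    rcases mem_block_of_mem_true (p := p) (q := q) hu with hu | rfl
    · exact hne u hu d hd
    · exact h.eq_of_mem hk (twice_sublist_word (.inr rfl)) hd hc
  obtain ⟨e, he, d, hd, hdc⟩ := h1
  obtain rfl : c = .x := InClass.eq_x_of_enclosed (B := block m π p q) hk h
    (fun e he => twice_sublist_word (.inl he)) hc he hd hdc.symm
  have hgx : ∀ c ∈ g .x, c = .x := fun c' hc' =>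
    h.eq_of_mem hk (twice_sublist_word (.inr rfl)) hc' hc
  have hz : ∀ i, ∃ u ∈ block m π p q, Letter.z (π i) ∈ g u := fun i => by
    have := pos_apply π i
    exact h.mem_block_image hk hc he hd hdc hgx (b := .z (π i))
      ⟨0, le_rfl, .inl rfl, _, by omega, ⟨(π i).2, .inl rfl⟩, _, by omega, .inr rfl, trivial⟩
      (by simp)
  have hy : ∀ n ≤ m, Letter.y n ∈ g (.y n) := fun n hn => h.y_mem_image hc hgx he hd hdc hn
  exact ⟨hc, hgx, hy 0 (Nat.zero_le _), hz,
    h.exists_first hc hgx (hy 0 (Nat.zero_le _)) (hz 0),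
    h.exists_last hc hgx (hy 0 (Nat.zero_le _)) (hy m le_rfl) (hz _)⟩

end
/-! ### Tests -/

/-- A substitution together with a left and a right context. -/
structure Test where
  pre : List Letter
  sub : Letter → List Letter
  post : List Letter

namespace Test

/-- The image of `l` under the substitution, put in the context, is in the `β`-class
of `a0 k π`. -/
def Passes (τ : Test) {k : ℕ} (π : Equiv.Perm (Fin k)) (l : List Letter) : Prop :=
  InClass π (τ.pre ++ l.flatMap τ.sub ++ τ.post)

/-- The substitution of a test after another substitution. -/
def comp (τ : Test) (φ : Letter → List Letter) (l : Letter) : List Letter := (φ l).flatMap τ.sub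

theorem mem_comp {τ : Test} {φ : Letter → List Letter} {c l : Letter} :
    c ∈ τ.comp φ l ↔ ∃ e ∈ φ l, c ∈ τ.sub e := List.mem_flatMap

theorem passes_iff {τ : Test} {k : ℕ} {π : Equiv.Perm (Fin k)} {φ : Letter → List Letter}
    {P X S : List Letter} : τ.Passes π (P ++ X.flatMap φ ++ S) ↔
      InClass π (τ.pre ++ P.flatMap τ.sub ++ X.flatMap (τ.comp φ) ++
        (S.flatMap τ.sub ++ τ.post)) := by
  rw [Passes, List.flatMap_append, List.flatMap_append, List.flatMap_assoc]
  simp only [List.append_assoc]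
  rfl

end Test

/-! ### Selection tests -/

section
variable {m : ℕ} {π : Equiv.Perm (Fin (m + 2))} {p q : Bool} {φ : Letter → List Letter}
  {P S : List Letter} {τ : Test}

/-- The substitution that leaves one of the first and one of the last letters of the block. -/
def selectSub (π : Equiv.Perm (Fin (m + 2))) (i j : ℕ) : Letter → List Letter
  | .x => [.x]
  | .y n => [.y n]
  | .z n => if n = m + 2 + i then [.z (π 0)] else if n = m + 5 + j then [.z (π (Fin.last _))]
      else if n < m + 2 ∧ n ≠ π 0 ∧ n ≠ π (Fin.last _) then [.z n] else []
  | .t n => if n = m + 2 + i then [.t (π 0)] else if n = m + 5 + j then [.t (π (Fin.last _))]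
      else if n < m + 2 then [.t n] else []

/-- The test that leaves one of the first and one of the last letters of the block. -/
def selectTest (π : Equiv.Perm (Fin (m + 2))) (i j : ℕ) : Test := ⟨[], selectSub π i j, []⟩

theorem mem_selectSub_x {i j : ℕ} {l : Letter} (h : .x ∈ selectSub π i j l) : l = .x := by
  cases l <;> simp only [selectSub] at h <;> (try split_ifs at h) <;> simp at h ⊢

theorem mem_selectSub_y {i j n : ℕ} {l : Letter} (h : .y n ∈ selectSub π i j l) : l = .y n := by
  cases l <;> simp only [selectSub] at h <;> (try split_ifs at h) <;> simp at h ⊢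
  exact h.symm

theorem last_ne_zero : π (Fin.last _) ≠ π 0 := by simp [Fin.ext_iff]

theorem mem_selectSub_first {i j : ℕ} {l : Letter} (h : .z (π 0) ∈ selectSub π i j l) :
    l = firstLetter m i := by
  have h0 := last_ne_zero (π := π)
  rw [Ne, Fin.ext_iff] at h0
  cases l <;> simp only [selectSub] at h <;> (try split_ifs at h) <;> simp at h ⊢ <;> omega

theorem mem_selectSub_last {i j : ℕ} {l : Letter}
    (h : .z (π (Fin.last _)) ∈ selectSub π i j l) : l = lastLetter m j := by
  have h0 := last_ne_zero (π := π)
  rw [Ne, Fin.ext_iff] at h0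
  cases l <;> simp only [selectSub] at h <;> (try split_ifs at h) <;> simp at h ⊢ <;> omega

/-- The alternative is uniform in the indices: if one test is spanning, then `φ` keeps `x` in the
image of `x` and `y 0` in that of `y 0`. Every selection fixes these two letters, so no other test
can be flat. -/
theorem selectTest_flat_or_spanning {I : Set (ℕ × ℕ)}
    (h : ∀ i ∈ I, (selectTest π i.1 i.2).Passes π (P ++ (word m π p q).flatMap φ ++ S)) :
    (∀ i ∈ I, Flat π ((selectTest π i.1 i.2).comp φ)) ∨
      ∀ i ∈ I, Spanning π p q ((selectTest π i.1 i.2).comp φ) := by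
  by_cases hf : ∀ i ∈ I, Flat π ((selectTest π i.1 i.2).comp φ)
  · exact .inl hf
  push Not at hf
  obtain ⟨i, hi, hf⟩ := hf
  have hs := (Test.passes_iff.mp (h i hi)).flat_or_spanning.resolve_left hf
  refine .inr fun j hj => (Test.passes_iff.mp (h j hj)).flat_or_spanning.resolve_left ?_
  obtain ⟨l, hl, hlx⟩ := Test.mem_comp.mp hs.x_mem
  obtain ⟨l', hl', hly⟩ := Test.mem_comp.mp hs.y_mem
  obtain rfl := mem_selectSub_x hlx
  obtain rfl := mem_selectSub_y hly
  have hx : .x ∈ (selectTest π j.1 j.2).comp φ .x :=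
    Test.mem_comp.mpr ⟨_, hl, List.mem_singleton.mpr rfl⟩
  have hy : .y 0 ∈ (selectTest π j.1 j.2).comp φ (.y 0) :=
    Test.mem_comp.mpr ⟨_, hl', List.mem_singleton.mpr rfl⟩
  rintro (hn | ⟨c, hc, hu⟩)
  · rw [hn] at hx
    simp at hx
  · have h1 := hu _ (mem_block_true (p := true) (q := true) (.inr rfl)) _ hx
    have h2 := hu _ (List.singleton_sublist.mp (core_sublist_block (List.nil_sublist _)
      (y_sublist_core (Nat.zero_le _)) (List.nil_sublist _))) _ hy
    rw [← h1] at h2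
    simp at h2

theorem Spanning.exists_mem_first {i j : ℕ} (h : Spanning π p q ((selectTest π i j).comp φ)) :
    ∃ s < 3, firstLetter m i ∈ φ (firstLetter m s) ∧ (p = true → s ≠ 0) ∧
      (s ≠ 0 → ∀ d ∈ (selectTest π i j).comp φ (firstLetter m 0), d = .x) := by
  obtain ⟨s, hs, hz, h1⟩ := h.exists_first
  obtain ⟨l, hl, hz⟩ := Test.mem_comp.mp hz
  obtain rfl := mem_selectSub_first hz
  exact ⟨s, hs, hl, h1⟩

theorem Spanning.exists_mem_last {i j : ℕ} (h : Spanning π p q ((selectTest π i j).comp φ)) :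
    ∃ s < 3, lastLetter m j ∈ φ (lastLetter m s) ∧ (q = true → s ≠ 2) ∧
      (s ≠ 2 → ∀ d ∈ (selectTest π i j).comp φ (lastLetter m 2), d = .x) := by
  obtain ⟨s, hs, hz, h1⟩ := h.exists_last
  obtain ⟨l, hl, hz⟩ := Test.mem_comp.mp hz
  obtain rfl := mem_selectSub_last hz
  exact ⟨s, hs, hl, h1⟩

/-- A splitting of `a0 (m + 2) π` at the two occurrences of the first `z`-letter of the block and
at the second `x`. -/
structure Splitting (π : Equiv.Perm (Fin (m + 2))) where
  rest : List Letter
  mid : List Letter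
  post : List Letter
  eq : (a0 (m + 2) π).toList = .x :: .z (π 0) :: .y 0 :: .y 0 :: rest ++ .x :: mid ++
    .z (π 0) :: post
  z_mem : .z (π 1) ∈ rest
  t_mem : .t (π 0) ∈ mid
  y_notMem : .y 0 ∉ mid

theorem nonempty_splitting (π : Equiv.Perm (Fin (m + 2))) : Nonempty (Splitting π) := by
  obtain ⟨L₁, L₂, hL⟩ := List.append_of_mem (List.mem_ofFn.mpr
    ⟨π 0, rfl⟩ : [Letter.t (π 0), .z (π 0)] ∈ List.ofFn fun i : Fin (m + 2) => [Letter.t i, .z i])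
  obtain ⟨M, hM⟩ : ∃ M, core m π = .y 0 :: .y 0 :: M := ⟨_, rfl⟩
  refine ⟨⟨M ++ [.z (π (Fin.last _))], L₁.flatten ++ [.t (π 0)], L₂.flatten, ?_, ?_, by simp, ?_⟩⟩
  · rw [toList_a0, hL, hM]
    simp
  · rw [List.mem_append, List.mem_singleton]
    cases m with
    | zero => exact .inr rfl
    | succ m =>
      left
      have h := (z_sublist_core (π := π) (0 : Fin (m + 1))).subset
        (show .z (π 1) ∈ _ by simp)
      rw [hM] at h
      simpa using h
  · have h : .y 0 ∉ (L₁ ++ [Letter.t (π 0), .z (π 0)] :: L₂).flatten := by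
      rw [← hL]
      simp [List.mem_flatten, List.mem_ofFn]
    simp at h ⊢
    tauto

/-! ### Order tests -/

variable (σ : Splitting π)

/-- The substitution of `negTest`. -/
def negSub (u v : Letter) (tu : Letter) (l : Letter) : List Letter :=
  if l = u then [.z (π 0)] else if l = v then [.y 0] else if l = tu then σ.rest ++ .x :: σ.mid
  else []

/-- The test that a letter of `φ v` never precedes a letter of `φ u` between two other
letters of `φ v`. -/
def negTest (u v tu : Letter) : Test := ⟨[.x], negSub σ u v tu, σ.post⟩

/-- The substitution of `posTest`. -/
def posSub (u v tu tv : Letter) (l : Letter) : List Letter :=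
  if l = u then [.x] else if l = v then [.z (π 0)] else if l = tu then .y 0 :: .y 0 :: σ.rest
  else if l = tv then σ.mid else []

/-- The test that two letters of `φ v` never stand between two letters of `φ u`. -/
def posTest (u v tu tv : Letter) : Test := ⟨[], posSub σ u v tu tv, σ.post⟩

variable {σ}

/-- A spanning image needs `z (π 1)` from a block letter. Only the image of `tu` supplies it, and it
brings along `t (π 0)`, which would then occur twice. -/
theorem negTest_flat {u v tu : Letter}
    (h : (negTest σ u v tu).Passes π (P ++ (word m π p q).flatMap φ ++ S)) :
    Flat π ((negTest σ u v tu).comp φ) := by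
  refine (Test.passes_iff.mp h).flat_or_spanning.resolve_right fun hs => ?_
  obtain ⟨w, hw, hz⟩ := hs.exists_z 1
  obtain ⟨l, hl, hz⟩ := Test.mem_comp.mp hz
  have h10 : π 1 ≠ π 0 := by simp
  rw [Ne, Fin.ext_iff] at h10
  refine (Test.passes_iff.mp h).t_notMem (by omega) (twice_sublist_word (.inl hw)) (π 0).2
    (Test.mem_comp.mpr ⟨l, hl, ?_⟩)
  simp only [negTest, negSub] at hz ⊢
  split_ifs at hz ⊢
  · simp at hz; omega
  · simp at hz
  · simp [σ.t_mem]
  · simp at hz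

/-- A spanning image has `y 0` in the image of `y 0`. Only the image of `tu` supplies it, together
with `z (π 1)`, but the image of a repeated letter involves a single letter. -/
theorem posTest_flat {u v tu tv : Letter}
    (h : (posTest σ u v tu tv).Passes π (P ++ (word m π p q).flatMap φ ++ S)) :
    Flat π ((posTest σ u v tu tv).comp φ) := by
  refine (Test.passes_iff.mp h).flat_or_spanning.resolve_right fun hs => ?_
  have hy := hs.y_mem
  obtain ⟨l, hl, hy'⟩ := Test.mem_comp.mp hy
  have hz : .z (π 1) ∈ (posTest σ u v tu tv).comp φ (.y 0) := by
    refine Test.mem_comp.mpr ⟨l, hl, ?_⟩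
    have := σ.y_notMem
    have := σ.z_mem
    simp only [posTest, posSub] at hy' ⊢
    split_ifs at hy' ⊢ <;> simp_all
  have := (Test.passes_iff.mp h).eq_of_mem (by omega) (twice_sublist_word (.inl
    (List.singleton_sublist.mp (core_sublist_block (List.nil_sublist _)
      (y_sublist_core (Nat.zero_le _)) (List.nil_sublist _))))) hy hz
  simp at this

/-- The two places of `y 0` are adjacent, so `z (π 0)` cannot come between two `y 0`. -/
theorem negTest_not_sublist {u v tu u' v' : Letter} (huv : u ≠ v)
    (h : (negTest σ u v tu).Passes π (P ++ (word m π p q).flatMap φ ++ S))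
    (hu : u ∈ φ u') (hv : v ∈ φ v') :
    ¬ [v', u', v'].Sublist (word m π p q) := by
  intro hs
  have hu1 : .z (π 0) ∈ (negTest σ u v tu).comp φ u' :=
    Test.mem_comp.mpr ⟨u, hu, by simp [negTest, negSub]⟩
  have hv1 : .y 0 ∈ (negTest σ u v tu).comp φ v' :=
    Test.mem_comp.mpr ⟨v, hv, by simp [negTest, negSub, huv.symm]⟩
  obtain ⟨r1, -, k1, r2, k12, k2, r3, k23, k3, -⟩ := (Test.passes_iff.mp h).ranked (by omega)
    (sublist_image hs (.cons hv1 (.cons hu1 (.cons hv1 .nil)))) (by simp)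
  simp only [hasRank_y] at k1 k3
  omega

theorem negTest_ne {u v tu u' v' : Letter} (huv : u ≠ v)
    (h : (negTest σ u v tu).Passes π (P ++ (word m π p q).flatMap φ ++ S))
    (hu : u ∈ φ u') (hv : v ∈ φ v') (hu' : u' ∈ block m π p q) : u' ≠ v' := by
  rintro rfl
  have := (Test.passes_iff.mp h).eq_of_mem (by omega) (twice_sublist_word (.inl hu'))
    (Test.mem_comp.mpr ⟨u, hu, by simp [negTest, negSub]; rfl⟩)
    (Test.mem_comp.mpr ⟨v, hv, by simp [negTest, negSub, huv.symm]; rfl⟩)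
  simp at this

/-- The forbidden pattern would put two occurrences of `z (π 0)` before an `x`. -/
theorem posTest_not_sublist {u v tu tv u' v' : Letter} (huv : u ≠ v)
    (h : (posTest σ u v tu tv).Passes π (P ++ (word m π p q).flatMap φ ++ S))
    (hu : u ∈ φ u') (hv : v ∈ φ v') :
    ¬ [u', v', v', u'].Sublist (word m π p q) := by
  intro hs
  have hu1 : .x ∈ (posTest σ u v tu tv).comp φ u' :=
    Test.mem_comp.mpr ⟨u, hu, by simp [posTest, posSub]⟩
  have hv1 : .z (π 0) ∈ (posTest σ u v tu tv).comp φ v' :=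
    Test.mem_comp.mpr ⟨v, hv, by simp [posTest, posSub, huv.symm]⟩
  exact (Test.passes_iff.mp h).not_zzx (by omega) (π 0).2 (.trans (List.sublist_cons_self .x _)
    (sublist_image hs (.cons hu1 (.cons hv1 (.cons hv1 (.cons hu1 .nil))))))

theorem posTest_ne {u v tu tv u' v' : Letter} (huv : u ≠ v)
    (h : (posTest σ u v tu tv).Passes π (P ++ (word m π p q).flatMap φ ++ S))
    (hu : u ∈ φ u') (hv : v ∈ φ v') (hu' : u' ∈ block m π p q) : u' ≠ v' := by
  rintro rfl
  have := (Test.passes_iff.mp h).eq_of_mem (by omega) (twice_sublist_word (.inl hu'))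
    (Test.mem_comp.mpr ⟨u, hu, by simp [posTest, posSub]; rfl⟩)
    (Test.mem_comp.mpr ⟨v, hv, by simp [posTest, posSub, huv.symm]; rfl⟩)
  simp at this

theorem first_mem_block {i : ℕ} (hi : i < 3) : firstLetter m i ∈ block m π p q := by
  refine List.singleton_sublist.mp (core_sublist_block (a := [_])
    (.trans (List.singleton_sublist.mpr ?_) first_sublist_firstGroup) (List.nil_sublist _)
    (List.nil_sublist _))
  interval_cases i <;> simp

theorem last_mem_block {i : ℕ} (hi : i < 3) : lastLetter m i ∈ block m π p q := by
  refine List.singleton_sublist.mp (core_sublist_block (List.nil_sublist _) (List.nil_sublist _)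
    (.trans (List.singleton_sublist.mpr ?_) last_sublist_lastGroup))
  interval_cases i <;> simp

/-- In the pattern 0, 1, 2, 0, 2, 1 the pair `(1, 2)` is the only pair of distinct indices `(i, j)`
for which `j i j` is not a subsequence. -/
theorem negTest_first {u v tu : Letter} (huv : u ≠ v)
    (h : (negTest σ u v tu).Passes π (P ++ (word m π p q).flatMap φ ++ S)) {i j : ℕ} (hi : i < 3)
    (hj : j < 3) (hu : u ∈ φ (firstLetter m i)) (hv : v ∈ φ (firstLetter m j)) :
    i = 1 ∧ j = 2 := by
  have h1 : i ≠ j := by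
    rintro rfl
    exact negTest_ne huv h hu hv (first_mem_block hi) rfl
  have h2 : ¬ [j, i, j].Sublist [0, 1, 2, 0, 2, 1] := fun hs =>
    negTest_not_sublist huv h hu hv (first_sublist_word hs)
  revert h1 h2
  interval_cases i <;> interval_cases j <;> decide

/-- In 0, 1, 2, 1, 0, 2 the only such pair is `(0, 1)`. -/
theorem negTest_last {u v tu : Letter} (huv : u ≠ v)
    (h : (negTest σ u v tu).Passes π (P ++ (word m π p q).flatMap φ ++ S)) {i j : ℕ} (hi : i < 3)
    (hj : j < 3) (hu : u ∈ φ (lastLetter m i)) (hv : v ∈ φ (lastLetter m j)) :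
    i = 0 ∧ j = 1 := by
  have h1 : i ≠ j := by
    rintro rfl
    exact negTest_ne huv h hu hv (last_mem_block hi) rfl
  have h2 : ¬ [j, i, j].Sublist [0, 1, 2, 1, 0, 2] := fun hs =>
    negTest_not_sublist huv h hu hv (last_sublist_word hs)
  revert h1 h2
  interval_cases i <;> interval_cases j <;> decide

/-- In 0, 1, 2, 0, 2, 1 the second 0 precedes the second 2, whereas 1, 2, 2, 1 is a subsequence. -/
theorem posTest_first {u v tu tv : Letter} (huv : u ≠ v)
    (h : (posTest σ u v tu tv).Passes π (P ++ (word m π p q).flatMap φ ++ S)) {i : ℕ} (hi : i < 3)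
    (hu : u ∈ φ (firstLetter m i)) (hv : v ∈ φ (firstLetter m 2)) : i = 0 := by
  have h1 : i ≠ 2 := by
    rintro rfl
    exact posTest_ne huv h hu hv (first_mem_block hi) rfl
  have h2 : ¬ [i, 2, 2, i].Sublist [0, 1, 2, 0, 2, 1] := fun hs =>
    posTest_not_sublist huv h hu hv (first_sublist_word hs)
  revert h1 h2
  interval_cases i <;> decide

theorem posTest_last {u v tu tv : Letter} (huv : u ≠ v)
    (h : (posTest σ u v tu tv).Passes π (P ++ (word m π p q).flatMap φ ++ S)) {j : ℕ} (hj : j < 3)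
    (hu : u ∈ φ (lastLetter m 0)) (hv : v ∈ φ (lastLetter m j)) : j = 2 := by
  have h1 : 0 ≠ j := by
    rintro rfl
    exact posTest_ne huv h hu hv (last_mem_block hj) rfl
  have h2 : ¬ [0, j, j, 0].Sublist [0, 1, 2, 1, 0, 2] := fun hs =>
    posTest_not_sublist huv h hu hv (last_sublist_word hs)
  revert h1 h2
  interval_cases j <;> decide

end
section
variable {m : ℕ} {π : Equiv.Perm (Fin (m + 2))} {p q : Bool} {φ : Letter → List Letter}
  {P S : List Letter}

/-! ### The values of the words of the identities under the tests -/

theorem flatMap_eq_self {α : Type*} {g : α → List α} {l : List α} (h : ∀ u ∈ l, g u = [u]) :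
    l.flatMap g = l := by
  induction l with
  | nil => rfl
  | cons a l ih =>
    rw [List.flatMap_cons, h a (by simp), ih fun u hu => h u (by simp [hu])]
    rfl

theorem flatMap_flatten_ofFn {α β : Type*} {n : ℕ} (f : Fin n → List α) (g : α → List β) :
    (List.ofFn f).flatten.flatMap g = (List.ofFn fun i => (f i).flatMap g).flatten := by
  induction n with
  | zero => simp
  | succ n ih => simp [List.ofFn_succ, ih]

theorem word_flatMap_selectSub {i j : ℕ} (hi : i < 3) (hj : j < 3) :
    (word m π false false).flatMap (selectSub π i j) = (a0 (m + 2) π).toList := by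
  have h1 : (firstGroup m false).flatMap (selectSub π i j) = [.z (π 0)] := by
    interval_cases i <;> interval_cases j <;> simp [firstGroup, selectSub]
  have h2 : (lastGroup m false).flatMap (selectSub π i j) = [.z (π (Fin.last _))] := by
    interval_cases j <;> interval_cases i <;> simp [lastGroup, selectSub]
  have h3 : (core m π).flatMap (selectSub π i j) = core m π := by
    refine flatMap_eq_self fun u hu => ?_
    rcases mem_core hu with ⟨n, -, rfl⟩ | ⟨n, rfl⟩
    · rfl
    · have h := (π n.castSucc.succ).2
      have h1 : π n.castSucc.succ ≠ π 0 := by simp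
      have h2 : π n.castSucc.succ ≠ π (Fin.last _) := by
        rw [Ne, π.injective.eq_iff, Fin.ext_iff]
        simp
        omega
      rw [Ne, Fin.ext_iff] at h1 h2
      simp only [selectSub]
      rw [if_neg (by omega), if_neg (by omega), if_pos ⟨h, h1, h2⟩]
  have h4 : (tail m π).flatMap (selectSub π i j) =
      (List.ofFn fun i : Fin (m + 2) => [Letter.t i, .z i]).flatten := by
    rw [tail, flatMap_flatten_ofFn]
    refine congrArg List.flatten (congrArg List.ofFn (funext fun n => ?_))
    unfold tailFactor
    split_ifs with h1 h2
    · subst h1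
      interval_cases i <;> interval_cases j <;> simp [selectSub]
    · subst h2
      interval_cases i <;> interval_cases j <;> simp [selectSub]
    · have h := n.2
      rw [Fin.ext_iff] at h1 h2
      have e1 : ¬ (n : ℕ) = m + 2 + i := by omega
      have e2 : ¬ (n : ℕ) = m + 5 + j := by omega
      simp [selectSub, e1, e2, h1, h2, h]
  rw [toList_a0]
  simp [word, block, h1, h2, h3, h4, selectSub]

theorem inClass_a0 {k : ℕ} {π : Equiv.Perm (Fin k)} : InClass π (a0 k π).toList :=
  beta.refl _

theorem selectTest_passes {i j : ℕ} (hi : i < 3) (hj : j < 3) :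
    (selectTest π i j).Passes π (word m π false false) := by
  simp only [Test.Passes, selectTest, word_flatMap_selectSub hi hj, List.nil_append,
    List.append_nil]
  exact inClass_a0

/-- The selected letter `lastLetter m 2` is the only source of the last `z`-letter, and the inserted
`x` stands before it. So the substitution cannot be spanning, and it visibly is not flat. -/
theorem not_selectTest_passes {i : ℕ} : ¬ (selectTest π i 2).Passes π (word m π p true) := by
  intro h
  have h : InClass π ([] ++ (word m π p true).flatMap (selectSub π i 2) ++ []) := h
  rcases h.flat_or_spanning with (h | ⟨c, hc, h⟩) | h
  · simp [selectSub] at h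
  · have := h (.y 0) (List.singleton_sublist.mp (core_sublist_block (List.nil_sublist _)
      (y_sublist_core (Nat.zero_le _)) (List.nil_sublist _))) (.y 0) (by simp [selectSub])
    simp [← this, selectSub] at hc
  · obtain ⟨s, -, hz, hs, -⟩ := h.exists_last
    have := mem_selectSub_last hz
    simp only [Letter.z.injEq] at this
    exact hs rfl (by omega)

theorem core_flatMap_eq_nil {g : Letter → List Letter} (hy : ∀ n, g (.y n) = [])
    (hz : ∀ n < m + 2, g (.z n) = []) : (core m π).flatMap g = [] := by
  rw [List.flatMap_eq_nil_iff]
  intro u hu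
  rcases mem_core hu with ⟨n, -, rfl⟩ | ⟨n, rfl⟩
  · exact hy n
  · exact hz _ (π _).2

theorem word_flatMap_first {g : Letter → List Letter}
    (hg : ∀ l, (∀ i < 3, l ≠ firstLetter m i ∧ l ≠ .t (m + 2 + i)) → g l = []) :
    (word m π false false).flatMap g = [firstLetter m 0, firstLetter m 1, firstLetter m 2,
      .t (m + 2), firstLetter m 0, .t (m + 2 + 2), firstLetter m 2,
      .t (m + 2 + 1), firstLetter m 1].flatMap g := by
  have hx : g .x = [] := hg _ (by simp)
  have hc : (core m π).flatMap g = [] :=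
    core_flatMap_eq_nil (fun n => hg _ (by simp)) fun n hn => hg _ (by simp; omega)
  have hl : (lastGroup m false).flatMap g = [] := by
    rw [List.flatMap_eq_nil_iff]
    intro u hu
    apply hg
    simp [lastGroup] at hu
    rcases hu with rfl | rfl | rfl <;> simp <;> omega
  have ht : (tail m π).flatMap g = (tailFactor m π (π 0)).flatMap g := by
    rw [tail, flatMap_flatten_ofFn]
    refine flatten_ofFn_eq _ fun i hi => ?_
    rw [List.flatMap_eq_nil_iff]
    intro u hu
    apply hg
    rw [tailFactor, if_neg hi] at hu
    have := i.2
    split_ifs at hu <;> simp at hu <;> rcases hu with rfl | rfl | rfl | rfl | rfl | rfl <;>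
      simp <;> omega
  simp only [word, block, List.flatMap_append, List.flatMap_cons, hx, hc, hl, ht]
  simp [firstGroup, tailFactor]

theorem word_flatMap_last {g : Letter → List Letter}
    (hg : ∀ l, (∀ i < 3, l ≠ lastLetter m i ∧ l ≠ .t (m + 5 + i)) → g l = []) :
    (word m π false false).flatMap g = [lastLetter m 0, lastLetter m 1, lastLetter m 2,
      .t (m + 5 + 1), lastLetter m 1, .t (m + 5), lastLetter m 0,
      .t (m + 5 + 2), lastLetter m 2].flatMap g := by
  have hx : g .x = [] := hg _ (by simp)
  have hc : (core m π).flatMap g = [] :=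
    core_flatMap_eq_nil (fun n => hg _ (by simp)) fun n hn => hg _ (by simp; omega)
  have hl : (firstGroup m false).flatMap g = [] := by
    rw [List.flatMap_eq_nil_iff]
    intro u hu
    apply hg
    simp [firstGroup] at hu
    rcases hu with rfl | rfl | rfl <;> simp <;> omega
  have ht : (tail m π).flatMap g = (tailFactor m π (π (Fin.last _))).flatMap g := by
    rw [tail, flatMap_flatten_ofFn]
    refine flatten_ofFn_eq _ fun i hi => ?_
    rw [List.flatMap_eq_nil_iff]
    intro u hu
    apply hg
    rw [tailFactor, if_neg hi] at hu
    have := i.2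
    split_ifs at hu <;> simp at hu <;> rcases hu with rfl | rfl | rfl | rfl | rfl | rfl <;>
      simp <;> omega
  simp only [word, block, List.flatMap_append, List.flatMap_cons, hx, hc, hl, ht]
  rw [tailFactor, if_neg last_ne_zero, if_pos rfl]
  simp [lastGroup]

variable (σ : Splitting π)

/-- Only the first letters and their simple letters survive, and substituting into 0, 1, 2, 0, 2, 1
reproduces the factorisation `σ.eq` literally. The other three order tests work in the same way. -/
theorem negTest_first_passes :
    (negTest σ (firstLetter m 1) (firstLetter m 2) (.t (m + 2 + 1))).Passes π
      (word m π false false) := by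
  have h := inClass_a0 (π := π)
  rw [σ.eq] at h
  rw [Test.Passes, word_flatMap_first]
  · simpa [negTest, negSub] using h
  · intro l hl
    simp [negTest, negSub, hl]

theorem negTest_last_passes :
    (negTest σ (lastLetter m 0) (lastLetter m 1) (.t (m + 5))).Passes π
      (word m π false false) := by
  have h := inClass_a0 (π := π)
  rw [σ.eq] at h
  rw [Test.Passes, word_flatMap_last]
  · simpa [negTest, negSub] using h
  · intro l hl
    have := hl 0 (by omega)
    simp [negTest, negSub, hl]
    simp_all

theorem posTest_first_passes :
    (posTest σ (firstLetter m 0) (firstLetter m 2) (.t (m + 2)) (.t (m + 2 + 2))).Passes π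
      (word m π false false) := by
  have h := inClass_a0 (π := π)
  rw [σ.eq] at h
  rw [Test.Passes, word_flatMap_first]
  · simpa [posTest, posSub] using h
  · intro l hl
    have := hl 0 (by omega)
    simp [posTest, posSub, hl]
    simp_all

theorem posTest_last_passes :
    (posTest σ (lastLetter m 0) (lastLetter m 2) (.t (m + 5)) (.t (m + 5 + 2))).Passes π
      (word m π false false) := by
  have h := inClass_a0 (π := π)
  rw [σ.eq] at h
  rw [Test.Passes, word_flatMap_last]
  · simpa [posTest, posSub] using h
  · intro l hl
    have := hl 0 (by omega)
    simp [posTest, posSub, hl]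
    simp_all

/-! ### Sets of tests -/

/-- The tests that determine the subvariety in which an `x` may be inserted among the last
letters. -/
def lastTests : Set Test :=
  -- These pairs select the last letters 0 and 1 but only the first letter 0; the pairs of
  -- `firstTests` select the first letters 1 and 2 but only the last letter 2. Just the union
  -- reaches all six letters.
  (fun i : ℕ × ℕ => selectTest π i.1 i.2) '' {(0, 0), (0, 1)} ∪
    {negTest σ (lastLetter m 0) (lastLetter m 1) (.t (m + 5)),
      posTest σ (lastLetter m 0) (lastLetter m 2) (.t (m + 5)) (.t (m + 5 + 2))}

/-- The tests that determine the subvariety in which an `x` may be inserted among the first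
letters. -/
def firstTests : Set Test :=
  (fun i : ℕ × ℕ => selectTest π i.1 i.2) '' {(1, 2), (2, 2)} ∪
    {negTest σ (firstLetter m 1) (firstLetter m 2) (.t (m + 2 + 1)),
      posTest σ (firstLetter m 0) (firstLetter m 2) (.t (m + 2)) (.t (m + 2 + 2))}

variable {σ}

theorem forall_lastTests {C : Test → Prop} : (∀ τ ∈ lastTests σ, C τ) ↔
    (∀ i ∈ ({(0, 0), (0, 1)} : Set (ℕ × ℕ)), C (selectTest π i.1 i.2)) ∧
    C (negTest σ (lastLetter m 0) (lastLetter m 1) (.t (m + 5))) ∧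
    C (posTest σ (lastLetter m 0) (lastLetter m 2) (.t (m + 5)) (.t (m + 5 + 2))) := by
  simp [lastTests, or_imp, forall_and]
  tauto

theorem forall_firstTests {C : Test → Prop} : (∀ τ ∈ firstTests σ, C τ) ↔
    (∀ i ∈ ({(1, 2), (2, 2)} : Set (ℕ × ℕ)), C (selectTest π i.1 i.2)) ∧
    C (negTest σ (firstLetter m 1) (firstLetter m 2) (.t (m + 2 + 1))) ∧
    C (posTest σ (firstLetter m 0) (firstLetter m 2) (.t (m + 2)) (.t (m + 2 + 2))) := by
  simp [firstTests, or_imp, forall_and]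
  tauto

theorem passes_of_flat {τ : Test} (hf : Flat π (τ.comp φ))
    (h : τ.Passes π (P ++ (word m π p q).flatMap φ ++ S)) (p' q' : Bool) :
    τ.Passes π (P ++ (word m π p' q').flatMap φ ++ S) :=
  Test.passes_iff.mpr ((Test.passes_iff.mp h).flat_congr hf p' q')

/-- In the spanning case `negTest` forces the last letters 0 and 1 to be produced by themselves.
Both differ from the letter 2, whose image under the selection tests is therefore a power of `x`,
and the `x` inserted before it merges with the closing `x`. -/
theorem lastTests_congr
    (h : ∀ τ ∈ lastTests σ, τ.Passes π (P ++ (word m π p q).flatMap φ ++ S)) (q' : Bool) :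
    ∀ τ ∈ lastTests σ, τ.Passes π (P ++ (word m π p q').flatMap φ ++ S) := by
  rw [forall_lastTests] at h ⊢
  obtain ⟨h1, h2, h3⟩ := h
  refine ⟨?_, passes_of_flat (negTest_flat h2) h2 _ _, passes_of_flat (posTest_flat h3) h3 _ _⟩
  rcases selectTest_flat_or_spanning h1 with hf | hs
  · exact fun i hi => passes_of_flat (hf i hi) (h1 i hi) _ _
  · have s0 := hs (0, 0) (by simp)
    have s1 := hs (0, 1) (by simp)
    obtain ⟨i, hi, hci, -, hxi⟩ := s0.exists_mem_last
    obtain ⟨j, hj, hcj, -, hxj⟩ := s1.exists_mem_last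
    obtain ⟨rfl, rfl⟩ := negTest_last (by simp) h2 hi hj hci hcj
    rintro i (rfl | rfl)
    · exact Test.passes_iff.mpr ((Test.passes_iff.mp (h1 _ (by simp))).congr_last s0.x_mem s0.eq_x
        (hxi (by simp)) q')
    · exact Test.passes_iff.mpr ((Test.passes_iff.mp (h1 _ (by simp))).congr_last s1.x_mem s1.eq_x
        (hxj (by simp)) q')

theorem firstTests_congr
    (h : ∀ τ ∈ firstTests σ, τ.Passes π (P ++ (word m π p q).flatMap φ ++ S)) (p' : Bool) :
    ∀ τ ∈ firstTests σ, τ.Passes π (P ++ (word m π p' q).flatMap φ ++ S) := by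
  rw [forall_firstTests] at h ⊢
  obtain ⟨h1, h2, h3⟩ := h
  refine ⟨?_, passes_of_flat (negTest_flat h2) h2 _ _, passes_of_flat (posTest_flat h3) h3 _ _⟩
  rcases selectTest_flat_or_spanning h1 with hf | hs
  · exact fun i hi => passes_of_flat (hf i hi) (h1 i hi) _ _
  · have s0 := hs (1, 2) (by simp)
    have s1 := hs (2, 2) (by simp)
    obtain ⟨i, hi, hci, -, hxi⟩ := s0.exists_mem_first
    obtain ⟨j, hj, hcj, -, hxj⟩ := s1.exists_mem_first
    obtain ⟨rfl, rfl⟩ := negTest_first (by simp) h2 hi hj hci hcj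
    rintro i (rfl | rfl)
    · exact Test.passes_iff.mpr ((Test.passes_iff.mp (h1 _ (by simp))).congr_first s0.x_mem
        s0.eq_x (hxi (by simp)) p')
    · exact Test.passes_iff.mpr ((Test.passes_iff.mp (h1 _ (by simp))).congr_first s1.x_mem
        s1.eq_x (hxj (by simp)) p')

/-- Suppose the selection tests are spanning. An insertion among the first letters forbids the first
letter 0 to be produced by itself. But `negTest` fixes the letters 1 and 2, and then `posTest`
forces 0 to be produced by itself. Symmetrically, for an insertion among the last letters, 0 and 1
are fixed and then 2 is forced, against the insertion before it. -/
theorem all_flat_of_true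
    (hl : ∀ τ ∈ lastTests σ, τ.Passes π (P ++ (word m π p q).flatMap φ ++ S))
    (hf : ∀ τ ∈ firstTests σ, τ.Passes π (P ++ (word m π p q).flatMap φ ++ S))
    (hpq : p = true ∨ q = true) :
    ∀ τ ∈ lastTests σ ∪ firstTests σ, Flat π (τ.comp φ) := by
  simp only [Set.mem_union, or_imp, forall_and]
  rw [forall_lastTests] at hl ⊢
  rw [forall_firstTests] at hf ⊢
  obtain ⟨h1, h2, h3⟩ := hl
  obtain ⟨k1, k2, k3⟩ := hf
  refine and_and_and_comm.mp ⟨?_, ⟨negTest_flat h2, posTest_flat h3⟩, negTest_flat k2,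
    posTest_flat k3⟩
  have h : ∀ i ∈ ({(0, 0), (0, 1)} ∪ {(1, 2), (2, 2)} : Set (ℕ × ℕ)),
      (selectTest π i.1 i.2).Passes π (P ++ (word m π p q).flatMap φ ++ S) := by
    simp only [Set.mem_union, or_imp, forall_and]
    exact ⟨h1, k1⟩
  rcases selectTest_flat_or_spanning h with hf | hs
  · exact ⟨fun i hi => hf i (.inl hi), fun i hi => hf i (.inr hi)⟩
  exfalso
  rcases hpq with rfl | rfl
  -- The sources of the first letters 0, 1, 2 come from selection tests of both sets: 0 from
  -- `lastTests`, 1 and 2 from `firstTests`.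
  · obtain ⟨i0, hi0, h0, hp, -⟩ := (hs (0, 0) (by simp)).exists_mem_first
    obtain ⟨i1, hi1, h1, -⟩ := (hs (1, 2) (by simp)).exists_mem_first
    obtain ⟨i2, hi2, h2, -⟩ := (hs (2, 2) (by simp)).exists_mem_first
    obtain ⟨rfl, rfl⟩ := negTest_first (by simp) k2 hi1 hi2 h1 h2
    exact hp rfl (posTest_first (by simp) k3 hi0 h0 h2)
  · obtain ⟨i0, hi0, g0, -⟩ := (hs (0, 0) (by simp)).exists_mem_last
    obtain ⟨i1, hi1, g1, -⟩ := (hs (0, 1) (by simp)).exists_mem_last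
    obtain ⟨i2, hi2, g2, hq, -⟩ := (hs (1, 2) (by simp)).exists_mem_last
    obtain ⟨rfl, rfl⟩ := negTest_last (by simp) h2 hi0 hi1 g0 g1
    exact hq rfl (posTest_last (by simp) h3 hi2 g0 g2)

theorem tests_congr
    (h : ∀ τ ∈ lastTests σ ∪ firstTests σ, τ.Passes π (P ++ (word m π p q).flatMap φ ++ S))
    (hpq : p = true ∨ q = true) (p' q' : Bool) :
    ∀ τ ∈ lastTests σ ∪ firstTests σ, τ.Passes π (P ++ (word m π p' q').flatMap φ ++ S) :=
  fun τ hτ => passes_of_flat (all_flat_of_true (fun τ hτ => h τ (.inl hτ))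
    (fun τ hτ => h τ (.inr hτ)) hpq τ hτ) (h τ hτ) p' q'

theorem word_passes : ∀ τ ∈ lastTests σ ∪ firstTests σ, τ.Passes π (word m π false false) := by
  simp only [Set.mem_union, or_imp, forall_and]
  rw [forall_lastTests, forall_firstTests]
  refine ⟨⟨?_, negTest_last_passes σ, posTest_last_passes σ⟩,
    ?_, negTest_first_passes σ, posTest_first_passes σ⟩
  · rintro i (rfl | rfl) <;> exact selectTest_passes (by simp) (by simp)
  · rintro i (rfl | rfl) <;> exact selectTest_passes (by simp) (by simp)

end
end Word

/-! ### Syntactic monoids -/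

/-- The syntactic congruence of a language. -/
def syntacticCon {M : Type*} [Monoid M] (K : Set M) : Con M where
  r a b := ∀ p s, p * a * s ∈ K ↔ p * b * s ∈ K
  iseqv := ⟨fun _ _ _ => Iff.rfl, fun h p s => (h p s).symm,
    fun h h' p s => (h p s).trans (h' p s)⟩
  mul' := by
    intro a b c d hab hcd p s
    have h1 := hab p (c * s)
    have h2 := hcd (p * b) s
    simp only [mul_assoc] at h1 h2 ⊢
    exact h1.trans h2

theorem satisfies_syntacticCon_iff {K : Set Word} {e : MonoidIdentity} :
    Satisfies (syntacticCon K).Quotient e ↔ ∀ (θ : Letter → Word) (p s : Word),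
      p * FreeMonoid.lift θ e.1 * s ∈ K ↔ p * FreeMonoid.lift θ e.2 * s ∈ K := by
  have key (θ : Letter → Word) (w : Word) : FreeMonoid.lift
      (fun l => (θ l : (syntacticCon K).Quotient)) w = (FreeMonoid.lift θ w : Word) := by
    have : FreeMonoid.lift (fun l => (θ l : (syntacticCon K).Quotient)) =
        (syntacticCon K).mk'.comp (FreeMonoid.lift θ) := FreeMonoid.hom_eq fun l => by simp
    rw [this]
    rfl
  constructor
  · intro h θ
    have := h fun l => (θ l : (syntacticCon K).Quotient)
    rw [key, key] at this
    exact (Con.eq _).mp this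
  · intro h φ
    choose θ hθ using fun l => Con.mk'_surjective (φ l)
    have hφ : φ = fun l => (θ l : (syntacticCon K).Quotient) := funext fun l => (hθ l).symm
    rw [hφ, key, key]
    exact (Con.eq _).mpr (h θ)

/-- The syntactic monoids live in the lowest universe, the variety in an arbitrary one. -/
theorem satisfies_ulift_iff {M : Type*} [Monoid M] {e : MonoidIdentity} :
    Satisfies (ULift.{u} M) e ↔ Satisfies M e := by
  have key (φ : Letter → ULift.{u} M) (w : Word) :
      (FreeMonoid.lift φ w).down = FreeMonoid.lift (fun l => (φ l).down) w := by
    have : MulEquiv.ulift.toMonoidHom.comp (FreeMonoid.lift φ) =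
        FreeMonoid.lift fun l => (φ l).down := FreeMonoid.hom_eq fun l => by simp; rfl
    rw [← this]
    rfl
  constructor
  · intro h φ
    have := congrArg ULift.down (h fun l => ⟨φ l⟩)
    rwa [key, key] at this
  · intro h φ
    apply ULift.down_injective
    rw [key, key]
    exact h _

/-! ### Syntactic monoids of languages defined by tests -/

namespace Word

section
variable {k : ℕ} {π : Equiv.Perm (Fin k)}

/-- The words that pass all tests of a set. -/
def passing (π : Equiv.Perm (Fin k)) (𝒯 : Set Test) : Set Word :=
  {w | ∀ τ ∈ 𝒯, τ.Passes π w.toList}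

/-- An identity of `M_β([a0 k π])` does not change the result of a test. -/
theorem Test.passes_congr {τ : Test} {e : MonoidIdentity}
    (h : Satisfies (SapirMonoid beta {(a0 k π : beta.Quotient)}) e) (θ : Letter → Word)
    (p s : Word) (hp : τ.Passes π (p * FreeMonoid.lift θ e.1 * s).toList) :
    τ.Passes π (p * FreeMonoid.lift θ e.2 * s).toList := by
  let ψ : Word →* Word := FreeMonoid.lift fun l => FreeMonoid.ofList (τ.sub l)
  have hψ (w : Word) : (ψ w).toList = w.toList.flatMap τ.sub := toList_lift _ _
  let c := sapirCon beta {(a0 k π : beta.Quotient)}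
  let f : Word →* c.Quotient := (c.mk'.comp beta.mk').comp ψ
  have key (w : Word) : FreeMonoid.lift (fun l => f (θ l)) w = f (FreeMonoid.lift θ w) := by
    have : FreeMonoid.lift (fun l => f (θ l)) = f.comp (FreeMonoid.lift θ) :=
      FreeMonoid.hom_eq fun l => by simp
    rw [this]
    rfl
  have h1 := h fun l => f (θ l)
  rw [key, key] at h1
  have hpass (w : Word) : τ.Passes π (p * w * s).toList ↔
      beta (FreeMonoid.ofList τ.pre * ψ p * ψ w * (ψ s * FreeMonoid.ofList τ.post))
        (a0 k π) := by
    have : FreeMonoid.ofList τ.pre * ψ p * ψ w * (ψ s * FreeMonoid.ofList τ.post) =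
        FreeMonoid.ofList (τ.pre ++ (p * w * s).toList.flatMap τ.sub ++ τ.post) := by
      apply FreeMonoid.toList.injective
      simp [hψ]
    rw [this]
    rfl
  rw [hpass] at hp ⊢
  -- Two values agree in the Rees quotient if they are `β`-related or both lie in the ideal. The
  -- latter is impossible: the value of the left side is a factor of the class of `a0 k π`, since
  -- the test is passed.
  rcases (Con.eq c).mp h1 with h2 | ⟨h2, -⟩
  · have h3 : beta (ψ (FreeMonoid.lift θ e.1)) (ψ (FreeMonoid.lift θ e.2)) := (Con.eq _).mp h2
    exact beta.trans (beta.mul (beta.mul (beta.refl _) (beta.symm h3)) (beta.refl _)) hp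
  · exact absurd ⟨_, rfl, ((FreeMonoid.ofList τ.pre * ψ p : Word) : beta.Quotient),
      ((ψ s * FreeMonoid.ofList τ.post : Word) : beta.Quotient), ((Con.eq _).mpr hp).symm⟩ h2

theorem satisfies_syntacticCon_passing (𝒯 : Set Test) {e : MonoidIdentity}
    (h : Satisfies (SapirMonoid beta {(a0 k π : beta.Quotient)}) e) :
    Satisfies (syntacticCon (passing π 𝒯)).Quotient e := by
  have h' : Satisfies (SapirMonoid beta {(a0 k π : beta.Quotient)}) e.swap :=
    fun φ => (h φ).symm
  exact satisfies_syntacticCon_iff.mpr fun θ p s =>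
    ⟨fun hp τ hτ => τ.passes_congr h θ p s (hp τ hτ),
      fun hp τ hτ => τ.passes_congr h' θ p s (hp τ hτ)⟩

/-- Passing the union means passing both sets, and an identity that preserves membership in two
languages preserves it in their intersection. This places the monoid of the union in the join. -/
theorem satisfies_syntacticCon_union {𝒯 𝒯' : Set Test} {e : MonoidIdentity}
    (h : Satisfies (syntacticCon (passing π 𝒯)).Quotient e)
    (h' : Satisfies (syntacticCon (passing π 𝒯')).Quotient e) :
    Satisfies (syntacticCon (passing π (𝒯 ∪ 𝒯'))).Quotient e := by
  have hu : passing π (𝒯 ∪ 𝒯') = passing π 𝒯 ∩ passing π 𝒯' := by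
    ext w
    simp [passing, or_imp, forall_and]
  rw [satisfies_syntacticCon_iff] at h h' ⊢
  intro θ p s
  rw [hu]
  exact and_congr (h θ p s) (h' θ p s)

theorem satisfies_syntacticCon_of {𝒯 : Set Test} {u v : List Letter}
    (h : ∀ (φ : Letter → List Letter) (P S : List Letter),
      (∀ τ ∈ 𝒯, τ.Passes π (P ++ u.flatMap φ ++ S)) ↔
        ∀ τ ∈ 𝒯, τ.Passes π (P ++ v.flatMap φ ++ S)) :
    Satisfies (syntacticCon (passing π 𝒯)).Quotient
      (FreeMonoid.ofList u, FreeMonoid.ofList v) := by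
  refine satisfies_syntacticCon_iff.mpr fun θ p s => ?_
  have := h (fun l => (θ l).toList) p.toList s.toList
  simpa only [passing, Set.mem_ofPred_eq, FreeMonoid.toList_mul, toList_lift,
    FreeMonoid.toList_ofList] using this

end

theorem mem_iff_of_satisfies {K : Set Word} {u v : Word}
    (h : Satisfies (syntacticCon K).Quotient (u, v)) : u ∈ K ↔ v ∈ K := by
  have h := satisfies_syntacticCon_iff.mp h FreeMonoid.of 1 1
  have hid : FreeMonoid.lift FreeMonoid.of = MonoidHom.id Word := FreeMonoid.hom_eq fun l => by simp
  simpa [hid] using h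

end Word

/-! ### Failure of distributivity -/

open Word MonoidVariety in
/-- For every `k ≥ 2` and every `π ∈ S_k`, the lattice of subvarieties of the variety generated by
the monoid `M_β([a_{0,k}[π]]^β)` is not distributive. -/
theorem mainTheorem5 (k : ℕ) (hk : 2 ≤ k) (π : Equiv.Perm (Fin k)) :
    ¬ (MonoidVariety.generatedBy.{u, 0}
        (SapirMonoid Word.beta {(Word.a0 k π : Word.beta.Quotient)})).IsDistributive := by
  obtain ⟨m, rfl⟩ := Nat.exists_eq_add_of_le' hk
  obtain ⟨σ⟩ := nonempty_splitting π
  set V := MonoidVariety.generatedBy.{u, 0}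
    (SapirMonoid Word.beta {(Word.a0 (m + 2) π : Word.beta.Quotient)}) with hV
  intro hdist
  let w (p q : Bool) : Word := FreeMonoid.ofList (word m π p q)
  let e₁ : MonoidIdentity := (w false true, w true false)
  let e₂ : MonoidIdentity := (w false false, w false true)
  let e₃ : MonoidIdentity := (w false false, w true false)
  let X : V.Subvarieties := ⟨V ⊓ ofIdentities {e₁}, Set.mem_Iic.mpr inf_le_left⟩
  let Y : V.Subvarieties := ⟨V ⊓ ofIdentities {e₂}, Set.mem_Iic.mpr inf_le_left⟩
  let Z : V.Subvarieties := ⟨V ⊓ ofIdentities {e₃}, Set.mem_Iic.mpr inf_le_left⟩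
  let N (𝒯 : Set Test) : MonCat.{u} := MonCat.of (ULift.{u} (syntacticCon (passing π 𝒯)).Quotient)
  have hN (𝒯 : Set Test) (e : MonoidIdentity) :
      Satisfies (N 𝒯) e ↔ Satisfies (syntacticCon (passing π 𝒯)).Quotient e :=
    satisfies_ulift_iff
  have hNV (𝒯 : Set Test) : N 𝒯 ∈ V.carrier := fun e he =>
    (hN 𝒯 e).mpr (satisfies_syntacticCon_passing 𝒯 he)
  have hmem (𝒯 : Set Test) (e : MonoidIdentity)
      (h : Satisfies (syntacticCon (passing π 𝒯)).Quotient e) :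
      N 𝒯 ∈ (V ⊓ ofIdentities {e}).carrier :=
    ⟨hNV 𝒯, by rintro _ rfl; exact (hN 𝒯 _).mpr h⟩
  -- Each side of the first identity carries an insertion, so every instance that passes is flat for
  -- all tests.
  have hX : N (lastTests σ ∪ firstTests σ) ∈ X.1.carrier :=
    hmem _ _ (satisfies_syntacticCon_of fun φ P S =>
      ⟨fun h => tests_congr h (.inr rfl) _ _, fun h => tests_congr h (.inl rfl) _ _⟩)
  have hY : N (lastTests σ) ∈ Y.1.carrier :=
    hmem _ _ (satisfies_syntacticCon_of fun φ P S =>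
      ⟨fun h => lastTests_congr h _, fun h => lastTests_congr h _⟩)
  have hZ : N (firstTests σ) ∈ Z.1.carrier :=
    hmem _ _ (satisfies_syntacticCon_of fun φ P S =>
      ⟨fun h => firstTests_congr h _, fun h => firstTests_congr h _⟩)
  have hYZ : N (lastTests σ ∪ firstTests σ) ∈ (Y ⊔ Z).1.carrier := fun e he =>
    (hN _ e).mpr (satisfies_syntacticCon_union ((hN _ e).mp (he.1 _ hY)) ((hN _ e).mp (he.2 _ hZ)))
  have hle : X ⊓ (Y ⊔ Z) ≤ ⟨V ⊓ ofIdentities {e₂}, Set.mem_Iic.mpr inf_le_left⟩ := by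
    rw [hdist X Y Z]
    refine sup_le inf_le_right ?_
    -- In the meet of `X` and `Z` the second identity follows by transitivity from `e₃` and the
    -- reverse of `e₁`.
    rintro M ⟨⟨hM, h1⟩, -, h3⟩
    refine ⟨hM, ?_⟩
    rintro _ rfl φ
    exact (h3 e₃ rfl φ).trans (h1 e₁ rfl φ).symm
  have hsat := (hN _ _).mp ((hle (show _ ∈ (X ⊓ (Y ⊔ Z)).1.carrier from ⟨hX, hYZ⟩)).2 e₂ rfl)
  have h := (mem_iff_of_satisfies hsat).mp fun τ hτ => word_passes τ hτ
  -- The pair `(1, 2)` comes from `firstTests`: it selects the last letter before which the right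
  -- side of `e₂` has its extra `x`.
  exact not_selectTest_passes (h (selectTest π 1 2) (.inr (.inl ⟨(1, 2), by simp, rfl⟩)))
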